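/- Let $K\ge 1$, $P_k>0$ and $\sigma_k>0$ for $1\le k\le K$, and let $\rho,\delta$ be real with $|\rho|<1$ and $\delta>0$, where either $\rho\ge 0$ or $\delta$ is an integer. Let $\alpha_0,\alpha_1,\dots,\alpha_K$ be independent circularly-symmetric complex normal $\mathcal{CN}(0,1)$ random variables and put $$h_k=\sigma_k\Big(\sqrt{1-\rho^{2(k+\delta-1)}}\,\alpha_k+\rho^{k+\delta-1}\alpha_0\Big),\quad \gamma_k=P_k|h_k|^2,\quad G=\prod_{k=1}^K(1+\gamma_k),\quad \Omega_k=P_k\sigma_k^2\big(1-\rho^{2(k+\delta-1)}\big).$$ Put $q_k=\rho^{2(k+\delta-1)}/(1-\rho^{2(k+\delta-1)})$, $w_k=q_k\big(1+\sum_{i=1}^K q_i\big)^{-1}$ and, for ${\bf l}\in\mathbb N_0^K$, $$W_{\bf l}=\Big(1+\sum_{k=1}^K q_k\Big)^{-1}\Big(\sum_{k=1}^K l_k\Big)!\,\prod_{k=1}^K\frac{w_k^{l_k}}{l_k!}.$$ These are the probabilities of the negative multinomial distribution $\mathrm{NM}(1,(w_1,\dots,w_K))$: $W_{\bf l}\ge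 0$ and $\sum_{\bf l}W_{\bf l}=1$. Let $\mathcal A_{\bf l}=\prod_{k=1}^K(1+R_{{\bf l},k})$ with independent $R_{{\bf l},k}$, Gamma distributed with shape $1+l_k$ and scale $\Omega_k$. Then $G$ and all $\mathcal A_{\bf l}$ have probability densities $f_G$, $f_{\mathcal A_{\bf l}}$, and for all real $x$ their CDFs satisfy $$F_G(x)=\int_0^x f_G(t)\,dt=\sum_{{\bf l}\in\mathbb N_0^K}W_{\bf l}\,F_{\mathcal A_{\bf l}}(x),\qquad F_{\mathcal A_{\bf l}}(x)=\int_0^x f_{\mathcal A_{\bf l}}(t)\,dt .$$ Moreover, for every $x>0$, $$F_{\mathcal A_{\bf l}}(x)=Y^{1,K}_{K+1,1}\left[\begin{array}{c}(0,1,\tfrac1{\Omega_1},1+l_1),\dots,(0,1,\tfrac1{\Omega_K},1+l_K),(1,1,0,1)\\(0,1,0,1)\end{array}\Big|\ \frac{\prod_{k=1}^K\Omega_k}{x}\right],$$ where the Mellin-Barnes integral converges absolutely along every line $\mathrm{Re}\,s=c$ with $c>0$. Here the generalized Fox H-function is $$Y^{m,n}_{p,q}\left[\begin{array}{c}(a_i,\alpha_i,A_i,\varphi_i)_{i\le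 p}\\(b_j,\beta_j,B_j,\phi_j)_{j\le q}\end{array}\Big|\ z\right]=\frac1{2\pi \mathrm i}\int_{c-\mathrm i\infty}^{c+\mathrm i\infty}\frac{\prod_{j\le m}\Xi(b_j,\beta_j,B_j,\phi_j)\prod_{i\le n}\Xi(1-a_i,-\alpha_i,A_i,\varphi_i)}{\prod_{i>n}\Xi(a_i,\alpha_i,A_i,\varphi_i)\prod_{j>m}\Xi(1-b_j,-\beta_j,B_j,\phi_j)}\,z^{-s}\,ds,$$ the line $\mathrm{Re}\,s=c$ separating the poles of the two groups of factors in the numerator, with $\Xi(a,\alpha,A,\varphi)=A^{\varphi+a+\alpha s-1}\,\Psi(\varphi,\varphi+a+\alpha s;A)$ for $A>0$, $\Xi(a,\alpha,0,\varphi)=\Gamma(\varphi+a+\alpha s-1)/\Gamma(\varphi)$ (the limit as $A\downarrow0$, continued analytically), and Tricomi's function $\Psi(a,b;z)=\frac1{\Gamma(a)}\int_0^\infty e^{-zt}t^{a-1}(1+t)^{b-a-1}\,dt$. Hence, for every real rate $\mathcal R$, the HARQ-IR outage probability $p_{out,K}=\Pr\big(\sum_{k=1}^K\log_2(1+\gamma_k)<\mathcal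 R\big)$ is $$p_{out,K}=F_G(2^{\mathcal R})=\sum_{{\bf l}\in\mathbb N_0^K}W_{\bf l}\,F_{\mathcal A_{\bf l}}(2^{\mathcal R}).$$ -/

import Mathlib

open MeasureTheory ProbabilityTheory

noncomputable section

namespace HarqIR

/-! ### Tricomi's function and the generalized Fox H-function -/

/-- Tricomi's confluent hypergeometric function `Ψ(a, b; z)` for `0 < re a`, `0 < re z`:
`Ψ(a, b; z) = Γ(a)⁻¹ ∫₀^∞ e^{-zt} t^{a-1} (1+t)^{b-a-1} dt`. -/
def tricomi (a b z : ℂ) : ℂ :=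
  (Complex.Gamma a)⁻¹ *
    ∫ t in Set.Ioi (0 : ℝ),
      Complex.exp (-z * t) * (t : ℂ) ^ (a - 1) * (1 + (t : ℂ)) ^ (b - a - 1)

/-- A parameter quadruple `(a, α, A, φ)` of the generalized Fox H-function. -/
structure FoxParam where
  a : ℝ
  α : ℝ
  A : ℝ
  φ : ℝ

/-- `Ξ(a, α, A, φ)(s) = A^{φ+a+αs-1} Ψ(φ, φ+a+αs; A)` for `A > 0`.  At `A = 0` it is the limit
of this expression as `A ↓ 0` (which exists for `re (φ+a+αs) > 1`), continued analytically, i.e.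
`Γ(φ+a+αs-1) / Γ(φ)`; in particular `Ξ(a, α, 0, 1)(s)` is the factor `Γ(a+αs)` of the ordinary
Fox H-function. -/
def foxXi (a α A φ : ℝ) (s : ℂ) : ℂ :=
  if A = 0 then Complex.Gamma (φ + a + α * s - 1) / Complex.Gamma φ
  else (A : ℂ) ^ ((φ : ℂ) + a + α * s - 1) * tricomi φ (φ + a + α * s) A

/-- The Mellin-Barnes kernel of `Y^{m,n}_{p,q}` with upper parameters `up` and lower parameters
`low`:
`∏_{j ≤ m} Ξ(b_j, β_j, B_j, ϕ_j) ∏_{i ≤ n} Ξ(1-a_i, -α_i, A_i, φ_i)` divided by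
`∏_{j > m} Ξ(1-b_j, -β_j, B_j, ϕ_j) ∏_{i > n} Ξ(a_i, α_i, A_i, φ_i)`. -/
def foxKernel (m n : ℕ) {p q : ℕ} (up : Fin p → FoxParam) (low : Fin q → FoxParam) (s : ℂ) : ℂ :=
  (∏ j : Fin q,
    if (j : ℕ) < m then foxXi (low j).a (low j).α (low j).A (low j).φ s
    else (foxXi (1 - (low j).a) (-(low j).α) (low j).A (low j).φ s)⁻¹) *
  (∏ i : Fin p,
    if (i : ℕ) < n then foxXi (1 - (up i).a) (-(up i).α) (up i).A (up i).φ s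
    else (foxXi (up i).a (up i).α (up i).A (up i).φ s)⁻¹)

/-- The line `re s = c` separates the poles of the two groups of numerator factors.  Only factors
with vanishing third parameter have poles; those of the first group have to lie to the left and
those of the second group to the right of the line (`α`, `β` being positive). -/
def FoxSeparates (m n : ℕ) {p q : ℕ} (up : Fin p → FoxParam) (low : Fin q → FoxParam)
    (c : ℝ) : Prop :=
  (∀ j : Fin q, (j : ℕ) < m → (low j).A = 0 →
    0 < (low j).φ + (low j).a + (low j).α * c - 1) ∧
  (∀ i : Fin p, (i : ℕ) < n → (up i).A = 0 →
    0 < (up i).φ + (1 - (up i).a) + (-(up i).α) * c - 1)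

/-- The generalized Fox H-function `Y^{m,n}_{p,q}[up; low | z]`, the Mellin-Barnes integral
`(2πi)⁻¹ ∫_{c-i∞}^{c+i∞} M(s) z^{-s} ds` along a separating line `re s = c`. -/
def foxY (c : ℝ) (m n : ℕ) {p q : ℕ} (up : Fin p → FoxParam) (low : Fin q → FoxParam)
    (z : ℝ) : ℂ :=
  mellinInv c (foxKernel m n up low) z

/-! ### The channel -/

/-- Parameters of the correlated Rayleigh channel with `K` transmissions: transmit powers `P_k`,
gains `σ_k`, time correlation `ρ` and feedback delay `δ`.  The index `k : Fin K` stands for the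
transmission number `k + 1`. -/
structure Channel (K : ℕ) where
  P : Fin K → ℝ
  σ : Fin K → ℝ
  ρ : ℝ
  δ : ℝ

namespace Channel

variable {K : ℕ} (C : Channel K)

/-- The correlation exponent: `k + δ - 1` for the transmission number `k`. -/
def expo (k : Fin K) : ℝ := (((k : ℕ) + 1 : ℕ) : ℝ) + C.δ - 1

/-- `Ω_k = P_k σ_k² (1 - ρ^{2(k+δ-1)})`. -/
def scale (k : Fin K) : ℝ := C.P k * C.σ k ^ 2 * (1 - C.ρ ^ (2 * C.expo k))

/-- `ρ^{2(k+δ-1)} / (1 - ρ^{2(k+δ-1)})`. -/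
def odds (k : Fin K) : ℝ := C.ρ ^ (2 * C.expo k) / (1 - C.ρ ^ (2 * C.expo k))

/-- `w_k`, the parameters of the negative multinomial distribution. -/
def w (k : Fin K) : ℝ := C.odds k * (1 + ∑ i, C.odds i)⁻¹

/-- `W_l`, the probability mass function of the negative multinomial distribution `NM(1, w)`. -/
def weight (l : Fin K → ℕ) : ℝ :=
  (1 + ∑ k, C.odds k)⁻¹ * ((∑ k, l k).factorial : ℝ) * ∏ k, C.w k ^ l k / ((l k).factorial : ℝ)

/-- The law of `A_l = ∏_k (1 + R_{l,k})` for independent `R_{l,k}` that are Gamma distributed with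
shape `1 + l_k` and scale `Ω_k` (that is, rate `1 / Ω_k`). -/
def shiftedGammaProd (l : Fin K → ℕ) : Measure ℝ :=
  (Measure.pi fun k => gammaMeasure (1 + l k) (1 / C.scale k)).map fun r => ∏ k, (1 + r k)

/-- The upper parameters `(0, 1, 1/Ω_1, 1+l_1), …, (0, 1, 1/Ω_K, 1+l_K), (1, 1, 0, 1)`. -/
def foxUp (l : Fin K → ℕ) : Fin (K + 1) → FoxParam :=
  Fin.snoc (fun k => ⟨0, 1, 1 / C.scale k, 1 + l k⟩) ⟨1, 1, 0, 1⟩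

/-- The lower parameter `(0, 1, 0, 1)`. -/
def foxLow : Fin 1 → FoxParam := fun _ => ⟨0, 1, 0, 1⟩

variable {S : Type*} (α : Fin (K + 1) → S → ℂ)

/-- The channel coefficient `h_k = σ_k (√(1 - ρ^{2(k+δ-1)}) α_k + ρ^{k+δ-1} α_0)`. -/
def coeff (k : Fin K) (ω : S) : ℂ :=
  C.σ k * ((√(1 - C.ρ ^ (2 * C.expo k)) : ℝ) * α k.succ ω + (C.ρ ^ C.expo k : ℝ) * α 0 ω)

/-- The received signal-to-noise ratio `γ_k = P_k |h_k|²`. -/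
def snr (k : Fin K) (ω : S) : ℝ := C.P k * ‖C.coeff α k ω‖ ^ 2

/-- `G = ∏_k (1 + γ_k)`. -/
def G (ω : S) : ℝ := ∏ k, (1 + C.snr α k ω)

/-- The accumulated mutual information `I_K = ∑_k log₂ (1 + γ_k)`. -/
def info (ω : S) : ℝ := ∑ k, Real.logb 2 (1 + C.snr α k ω)

/-- The outage probability `p_out,K = Pr(I_K < R)`. -/
def outage [MeasurableSpace S] (μ : Measure S) (R : ℝ) : ℝ := μ.real {ω | C.info α ω < R}

end Channel

/-- The circularly-symmetric complex normal law `CN(0, 1)`: independent real and imaginary parts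
with law `N(0, 1/2)`. -/
def stdComplexNormal : Measure ℂ :=
  ((gaussianReal 0 (1 / 2)).prod (gaussianReal 0 (1 / 2))).map fun p => (⟨p.1, p.2⟩ : ℂ)

/-- The probability density function of a law on the real line. -/
def density (ν : Measure ℝ) (x : ℝ) : ℝ := (ν.rnDeriv volume x).toReal

end HarqIR

end

/-!
Divide `h_k` by the coefficient of `α_k`. Given `α_0`, the vector `(|α_k + c_k α_0|²)_k` has
independent noncentral exponential coordinates, and each of these is a Poisson mixture of the Gamma
laws with shapes `1 + l`, with parameter `|c_k α_0|²`. Since `|α_0|²` is exponential, averaging the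
product of the Poisson weights over `α_0` yields negative multinomial weights; hence the law of `G`
is the mixture of the laws of the `A_l` with weights `W_l`.

The Mellin transform of `z ↦ F_A(M / z)` is `M ^ s * E[A ^ (-s)] / s`. For `A = A_l` and
`M = ∏ Ω_k` the factors `Ω_k ^ s * E[(1 + R_k) ^ (-s)]` are Tricomi functions and
`1 / s = Γ(s) / Γ(s + 1)`, so this transform is the kernel of the Fox H-function. One integration
by parts in the Gamma integral gives `E[A ^ (-s)] = O(1 / |s|)`, so the kernel is integrable on
vertical lines and Mellin inversion applies.
-/

namespace HarqIR

open Filter Topology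
open scoped ENNReal NNReal

section Mixtures

theorem prod_tsum_eq_tsum_prod {K : ℕ} {κ : Type*} (f : Fin K → κ → ℝ≥0∞) :
    ∏ k, ∑' n, f k n = ∑' l : Fin K → κ, ∏ k, f k (l k) := by
  induction K with
  | zero => simp
  | succ K ih =>
    calc ∏ k, ∑' n, f k n = ∑' n, ∑' l : Fin K → κ, f 0 n * ∏ k, f k.succ (l k) := by
          simp_rw [Fin.prod_univ_succ, ih, ← ENNReal.tsum_mul_right, ← ENNReal.tsum_mul_left]
      _ = ∑' p : κ × (Fin K → κ), ∏ k, f k (Fin.consEquiv (fun _ => κ) p k) := by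
          simp [ENNReal.tsum_prod', Fin.consEquiv, Fin.prod_univ_succ]
      _ = ∑' l : Fin (K + 1) → κ, ∏ k, f k (l k) :=
          (Fin.consEquiv fun _ => κ).tsum_eq fun l => ∏ k, f k (l k)

theorem pi_sum_smul {K : ℕ} {κ : Type*} {X : Fin K → Type*} [∀ k, MeasurableSpace (X k)]
    (c : Fin K → κ → ℝ≥0∞) (ν : ∀ k, κ → Measure (X k)) [∀ k n, SigmaFinite (ν k n)]
    [∀ k, SigmaFinite (Measure.sum fun n => c k n • ν k n)] :
    Measure.pi (fun k => Measure.sum fun n => c k n • ν k n) =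
      Measure.sum fun l : Fin K → κ => (∏ k, c k (l k)) • Measure.pi fun k => ν k (l k) := by
  refine Measure.pi_eq fun s hs => ?_
  rw [Measure.sum_apply _ (MeasurableSet.univ_pi hs)]
  simp_rw [Measure.sum_apply _ (hs _), prod_tsum_eq_tsum_prod, Measure.smul_apply, Measure.pi_pi,
    smul_eq_mul, Finset.prod_mul_distrib]

theorem hasSum_mul_measureReal {ι X : Type*} [MeasurableSpace X] {w : ι → ℝ} (hw : ∀ i, 0 ≤ w i)
    (ν : ι → Measure X) [IsFiniteMeasure (Measure.sum fun i => ENNReal.ofReal (w i) • ν i)]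
    {s : Set X} (hs : MeasurableSet s) :
    HasSum (fun i => w i * (ν i).real s)
      ((Measure.sum fun i => ENNReal.ofReal (w i) • ν i).real s) := by
  have hfin := measure_ne_top (Measure.sum fun i => ENNReal.ofReal (w i) • ν i) s
  rw [Measure.sum_apply _ hs] at hfin
  have hsum := ENNReal.hasSum_toReal hfin
  rw [← ENNReal.tsum_toReal_eq fun i => ENNReal.ne_top_of_tsum_ne_top hfin i,
    ← Measure.sum_apply _ hs] at hsum
  simpa [measureReal_def, ENNReal.toReal_mul, ENNReal.toReal_ofReal (hw _)] using hsum

theorem isProbabilityMeasure_mixture {κ X : Type*} [MeasurableSpace κ] [Countable κ]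
    [MeasurableSingletonClass κ] [MeasurableSpace X] (p : Measure κ) [IsProbabilityMeasure p]
    (ν : κ → Measure X) [∀ n, IsProbabilityMeasure (ν n)] :
    IsProbabilityMeasure (Measure.sum fun n => p {n} • ν n) where
  measure_univ := by
    rw [Measure.sum_apply _ MeasurableSet.univ]
    simpa using (lintegral_countable' (μ := p) 1).symm

theorem hasSum_charFun_sum {κ : Type*} (ν : κ → Measure ℝ) [IsFiniteMeasure (Measure.sum ν)]
    (t : ℝ) : HasSum (fun n => charFun (ν n) t) (charFun (Measure.sum ν) t) := by
  simp_rw [charFun_apply_real]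
  refine hasSum_integral_measure
    ((integrable_const (1 : ℝ)).mono' (by fun_prop) (ae_of_all _ fun x => ?_))
  rw [← Complex.ofReal_mul, Complex.norm_exp_ofReal_mul_I]

end Mixtures

section Densities

theorem cdf_eq_integral_density (ν : Measure ℝ) [IsProbabilityMeasure ν] (hν : ν ≪ volume)
    (hpos : ∀ᵐ t ∂ν, 0 < t) (x : ℝ) : cdf ν x = ∫ t in (0 : ℝ)..x, density ν t := by
  have hnull : ν (Set.Iic 0) = 0 := measure_eq_zero_iff_ae_notMem.2 (hpos.mono fun _ => not_le.2)
  have hset (s : Set ℝ) : ∫ t in s, density ν t = ν.real s :=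
    Measure.setIntegral_toReal_rnDeriv hν s
  rw [cdf_eq_real]
  rcases le_total 0 x with hx | hx
  · rw [intervalIntegral.integral_of_le hx, hset, ← Set.Iic_union_Ioc_eq_Iic hx,
      measureReal_union (Set.Iic_disjoint_Ioc le_rfl) measurableSet_Ioc,
      measureReal_def ν (Set.Iic 0), hnull, ENNReal.toReal_zero, zero_add]
  · rw [intervalIntegral.integral_of_ge hx, hset, measureReal_def, measureReal_def,
      measure_mono_null (Set.Iic_subset_Iic.2 hx) hnull,
      measure_mono_null Set.Ioc_subset_Iic_self hnull, ENNReal.toReal_zero, neg_zero]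

theorem continuous_cdf (ν : Measure ℝ) [IsProbabilityMeasure ν] [NullSingletonClass ν] :
    Continuous (cdf ν) := by
  refine continuous_iff_continuousAt.2 fun x => ?_
  have hjump : ENNReal.ofReal (cdf ν x - Function.leftLim (cdf ν) x) = 0 := by
    rw [← StieltjesFunction.measure_singleton, measure_cdf, measure_singleton]
  rw [(cdf ν).mono.continuousAt_iff_leftLim_eq_rightLim, StieltjesFunction.rightLim_eq]
  exact ((cdf ν).mono.leftLim_le le_rfl).antisymm
    (sub_nonpos.1 (ENNReal.ofReal_eq_zero.1 hjump))

variable {S : Type*} [MeasurableSpace S] {μ : Measure S} [IsFiniteMeasure μ]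

theorem absolutelyContinuous_map_mul {X Y : S → ℝ} (hXY : IndepFun X Y μ) (hX : AEMeasurable X μ)
    (hY : AEMeasurable Y μ) (hac : μ.map X ≪ volume) (hY0 : ∀ᵐ ω ∂μ, Y ω ≠ 0) :
    μ.map (X * Y) ≪ volume := by
  refine Measure.AbsolutelyContinuous.mk fun s hs hs0 => ?_
  have hmul : Measurable fun p : ℝ × ℝ => p.2 * p.1 := by fun_prop
  have hlaw : μ.map (X * Y) = ((μ.map Y).prod (μ.map X)).map fun p => p.2 * p.1 := by
    rw [← (indepFun_iff_map_prod_eq_prod_map_map hY hX).1 hXY.symm,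
      AEMeasurable.map_map_of_aemeasurable hmul.aemeasurable (hY.prodMk hX)]
    rfl
  rw [hlaw, Measure.map_apply hmul hs, Measure.measure_prod_null (hmul hs)]
  filter_upwards [(ae_map_iff hY (measurableSet_singleton 0).compl).2 hY0] with y hy
  have hslice : volume ((· * y) ⁻¹' s) = 0 := by
    rw [Real.volume_preimage_mul_right hy, hs0, mul_zero]
  exact hac hslice

theorem absolutelyContinuous_map_prod {ι : Type*} [Fintype ι] {X : ι → S → ℝ} (hX : iIndepFun X μ)
    (hm : ∀ i, AEMeasurable (X i) μ) (hX0 : ∀ i, ∀ᵐ ω ∂μ, X i ω ≠ 0) {i : ι}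
    (hac : μ.map (X i) ≪ volume) : μ.map (∏ i, X i) ≪ volume := by
  classical
  rw [← Finset.mul_prod_erase _ _ (Finset.mem_univ i)]
  refine absolutelyContinuous_map_mul
    (hX.indepFun_finsetProd_of_notMem₀ hm (Finset.notMem_erase i _)).symm (hm i)
    (Finset.aemeasurable_prod _ fun j _ => hm j) hac ?_
  filter_upwards [ae_all_iff.2 hX0] with ω hω
  rw [Finset.prod_apply]
  exact Finset.prod_ne_zero_iff.2 fun j _ => hω j

theorem measurable_prod_one_add {ι : Type*} [Fintype ι] :
    Measurable fun r : ι → ℝ => ∏ i, (1 + r i) := by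
  fun_prop

theorem absolutelyContinuous_map_pi_prod_one_add {ι : Type*} [Fintype ι] {ν : ι → Measure ℝ}
    [∀ i, IsProbabilityMeasure (ν i)] (hν : ∀ i, ∀ᵐ x ∂ν i, 1 + x ≠ 0) {i : ι}
    (hac : ν i ≪ volume) : (Measure.pi ν).map (fun r => ∏ i, (1 + r i)) ≪ volume := by
  have hindep : iIndepFun (fun i (r : ι → ℝ) => 1 + r i) (Measure.pi ν) :=
    iIndepFun_pi fun i => by fun_prop
  have hfactor : (Measure.pi ν).map (fun r => 1 + r i) ≪ volume := by
    have hmap : (Measure.pi ν).map (fun r => 1 + r i) = (ν i).map (1 + ·) := by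
      rw [← (measurePreserving_eval ν i).map_eq, Measure.map_map (by fun_prop) (by fun_prop)]
      rfl
    rw [hmap, ← (measurePreserving_add_left volume (1 : ℝ)).map_eq]
    exact hac.map (by fun_prop)
  have hprod := absolutelyContinuous_map_prod hindep
    (fun i => ((measurable_pi_apply i).const_add 1).aemeasurable)
    (fun i => (measurePreserving_eval ν i).quasiMeasurePreserving.ae (hν i)) hfactor
  simpa only [Finset.prod_fn] using hprod

end Densities

section Gamma

theorem absolutelyContinuous_gammaMeasure (a r : ℝ) : gammaMeasure a r ≪ volume :=
  withDensity_absolutelyContinuous _ _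

theorem measurable_gammaPDF (a r : ℝ) : Measurable (gammaPDF a r) :=
  (measurable_gammaPDFReal a r).ennreal_ofReal

theorem ae_gammaMeasure_pos (a r : ℝ) : ∀ᵐ x ∂gammaMeasure a r, 0 < x := by
  rw [gammaMeasure, ae_withDensity_iff (measurable_gammaPDF a r)]
  filter_upwards [compl_mem_ae_iff.2 (measure_singleton (0 : ℝ))] with x hx hpdf
  by_contra hneg
  exact hpdf (gammaPDF_of_neg (lt_of_le_of_ne (not_lt.1 hneg) hx))

theorem integral_gammaMeasure {a r : ℝ} (ha : 0 < a) (hr : 0 < r) (f : ℝ → ℂ) :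
    ∫ x, f x ∂gammaMeasure a r =
      (r ^ a / Real.Gamma a : ℝ) *
        ∫ t in Set.Ioi (0 : ℝ), (t ^ (a - 1) * Real.exp (-r * t) : ℝ) * f t := by
  have hpos : (gammaMeasure a r).restrict (Set.Ioi 0) = gammaMeasure a r :=
    Measure.restrict_eq_self_of_ae_mem (ae_gammaMeasure_pos a r)
  rw [← hpos, gammaMeasure, setIntegral_withDensity_eq_setIntegral_toReal_smul
    (measurable_gammaPDF a r) (by simp [gammaPDF]) f measurableSet_Ioi,
    ← integral_const_mul]
  refine setIntegral_congr_fun measurableSet_Ioi fun t (ht : 0 < t) => ?_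
  have hpdf : (gammaPDF a r t).toReal =
      r ^ a / Real.Gamma a * (t ^ (a - 1) * Real.exp (-r * t)) := by
    rw [gammaPDF, ENNReal.toReal_ofReal (gammaPDFReal_nonneg ha hr t), gammaPDFReal, if_pos ht.le,
      neg_mul, mul_assoc]
  simp only [hpdf, Complex.real_smul]
  push_cast
  ring

theorem integrableOn_pow_mul_exp_neg_mul (n : ℕ) {r : ℝ} (hr : 0 < r) :
    IntegrableOn (fun t : ℝ => t ^ n * Real.exp (-r * t)) (Set.Ioi 0) := by
  have hn : (-1 : ℝ) < n := neg_one_lt_zero.trans_le n.cast_nonneg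
  simpa using integrableOn_rpow_mul_exp_neg_mul_rpow hn one_pos hr

theorem tendsto_pow_mul_exp_neg_mul_atTop (n : ℕ) {r : ℝ} (hr : 0 < r) :
    Tendsto (fun t : ℝ => t ^ n * Real.exp (-r * t)) atTop (𝓝 0) := by
  simpa using tendsto_rpow_mul_exp_neg_mul_atTop_nhds_zero n r hr

theorem norm_pow_mul_cexp_neg_mul (n : ℕ) (z : ℂ) {t : ℝ} (ht : 0 ≤ t) :
    ‖(t : ℂ) ^ n * Complex.exp (-z * t)‖ = t ^ n * Real.exp (-z.re * t) := by
  rw [norm_mul, norm_pow, Complex.norm_real, Real.norm_of_nonneg ht, Complex.norm_exp]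
  simp

theorem integrableOn_pow_mul_cexp_neg_mul (n : ℕ) {z : ℂ} (hz : 0 < z.re) :
    IntegrableOn (fun t : ℝ => (t : ℂ) ^ n * Complex.exp (-z * t)) (Set.Ioi 0) :=
  (integrableOn_pow_mul_exp_neg_mul n hz).mono'
    (by fun_prop : Continuous fun t : ℝ => (t : ℂ) ^ n * Complex.exp (-z * t)).aestronglyMeasurable
    ((ae_restrict_mem measurableSet_Ioi).mono fun _ ht =>
      (norm_pow_mul_cexp_neg_mul n z (le_of_lt ht)).le)

theorem mul_integral_pow_succ_mul_cexp_neg_mul (n : ℕ) {z : ℂ} (hz : 0 < z.re) :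
    z * ∫ t in Set.Ioi (0 : ℝ), (t : ℂ) ^ (n + 1) * Complex.exp (-z * t) =
      (n + 1) * ∫ t in Set.Ioi (0 : ℝ), (t : ℂ) ^ n * Complex.exp (-z * t) := by
  have hderiv (t : ℝ) : HasDerivAt (fun t : ℝ => (t : ℂ) ^ (n + 1) * Complex.exp (-z * t))
      ((n + 1) * ((t : ℂ) ^ n * Complex.exp (-z * t)) -
        z * ((t : ℂ) ^ (n + 1) * Complex.exp (-z * t))) t := by
    refine HasDerivAt.comp_ofReal (e := fun w : ℂ => w ^ (n + 1) * Complex.exp (-z * w)) <|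
      ((hasDerivAt_pow (n + 1) (t : ℂ)).mul
        ((hasDerivAt_id (t : ℂ)).const_mul (-z)).cexp).congr_deriv ?_
    simp only [id_eq, Nat.add_sub_cancel, Nat.cast_add, Nat.cast_one]
    ring
  have hlim : Tendsto (fun t : ℝ => (t : ℂ) ^ (n + 1) * Complex.exp (-z * t)) atTop (𝓝 0) :=
    tendsto_zero_iff_norm_tendsto_zero.2 <| (tendsto_pow_mul_exp_neg_mul_atTop (n + 1) hz).congr' <|
      (eventually_ge_atTop 0).mono fun _ ht => (norm_pow_mul_cexp_neg_mul (n + 1) z ht).symm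
  have hint := (integrableOn_pow_mul_cexp_neg_mul n hz).const_mul (n + 1 : ℂ)
  have hint' := (integrableOn_pow_mul_cexp_neg_mul (n + 1) hz).const_mul z
  have hparts := integral_Ioi_of_hasDerivAt_of_tendsto' (fun t _ => hderiv t)
    (hint.sub hint') hlim
  rw [integral_sub hint hint', integral_const_mul, integral_const_mul, Complex.ofReal_zero,
    zero_pow n.succ_ne_zero, zero_mul, sub_zero] at hparts
  exact (sub_eq_zero.1 hparts).symm

theorem integral_pow_mul_cexp_neg_mul (n : ℕ) {z : ℂ} (hz : 0 < z.re) :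
    ∫ t in Set.Ioi (0 : ℝ), (t : ℂ) ^ n * Complex.exp (-z * t) = n.factorial / z ^ (n + 1) := by
  have hz0 : z ≠ 0 := by
    rintro rfl
    simp at hz
  induction n with
  | zero =>
    simp only [pow_zero, one_mul, integral_exp_mul_complex_Ioi (a := -z) (by simpa using hz) 0]
    simp
  | succ n ih =>
    rw [← mul_right_inj' hz0, mul_integral_pow_succ_mul_cexp_neg_mul n hz, ih, Nat.factorial_succ,
      pow_succ z (n + 1)]
    push_cast
    field_simp

theorem charFun_gammaMeasure_one_add_nat (n : ℕ) {r : ℝ} (hr : 0 < r) (t : ℝ) :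
    charFun (gammaMeasure (1 + n) r) t = (1 - (t / r : ℝ) * Complex.I)⁻¹ ^ (n + 1) := by
  have hn : (n.factorial : ℂ) ≠ 0 := Nat.cast_ne_zero.2 n.factorial_ne_zero
  have hr0 : (r : ℂ) ≠ 0 := Complex.ofReal_ne_zero.2 hr.ne'
  have hbase : (1 - (t / r : ℝ) * Complex.I)⁻¹ = r / (r - t * Complex.I) := by
    rw [← inv_div (r - t * Complex.I : ℂ), sub_div, div_self hr0, Complex.ofReal_div,
      div_mul_eq_mul_div]
  have hexp (x : ℝ) : ((x ^ ((1 + n : ℝ) - 1) * Real.exp (-r * x) : ℝ) : ℂ) *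
      Complex.exp (t * x * Complex.I) = (x : ℂ) ^ n * Complex.exp (-(r - t * Complex.I) * x) := by
    rw [add_sub_cancel_left, Real.rpow_natCast]
    push_cast
    rw [mul_assoc, ← Complex.exp_add]
    ring_nf
  rw [charFun_apply_real, integral_gammaMeasure (by positivity) hr]
  simp_rw [hexp]
  rw [integral_pow_mul_cexp_neg_mul n (by simpa using hr), hbase, div_pow, add_comm (1 : ℝ),
    Real.Gamma_nat_eq_factorial, ← Nat.cast_succ, Real.rpow_natCast]
  push_cast
  field_simp

end Gamma

section ComplexNormal

instance : IsProbabilityMeasure stdComplexNormal :=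
  Measure.isProbabilityMeasure_map Complex.measurableEquivRealProd.symm.measurable.aemeasurable

theorem one_sub_ofReal_mul_I_ne_zero (τ : ℝ) : (1 - τ * Complex.I : ℂ) ≠ 0 := fun h => by
  simpa using congrArg Complex.re h

theorem integral_gaussianReal_cexp_add_sq (τ a : ℝ) :
    ∫ x, Complex.exp (τ * (x + a) ^ 2 * Complex.I) ∂gaussianReal 0 (1 / 2) =
      (√Real.pi)⁻¹ * (Real.pi / (1 - τ * Complex.I)) ^ (1 / 2 : ℂ) *
        Complex.exp (a ^ 2 * ((1 - τ * Complex.I)⁻¹ - 1)) := by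
  have hz := one_sub_ofReal_mul_I_ne_zero τ
  have hquad (x : ℝ) :
      gaussianPDFReal 0 (1 / 2) x • Complex.exp (τ * (x + a) ^ 2 * Complex.I) =
        (√Real.pi)⁻¹ * Complex.exp (-(1 - τ * Complex.I) * x ^ 2 + 2 * τ * a * Complex.I * x +
          τ * a ^ 2 * Complex.I) := by
    have hvar : 2 * Real.pi * ((1 / 2 : ℝ≥0) : ℝ) = Real.pi := by
      push_cast
      ring
    rw [gaussianPDFReal, hvar, Complex.real_smul]
    push_cast
    rw [mul_assoc, ← Complex.exp_add]
    ring_nf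
  rw [integral_gaussianReal_eq_integral_smul (by simp)]
  simp_rw [hquad]
  rw [integral_const_mul, integral_cexp_quadratic (by simp), ← mul_assoc, neg_neg]
  congr 2
  field_simp
  ring_nf

theorem integral_stdComplexNormal_cexp_norm_add_sq (τ : ℝ) (v : ℂ) :
    ∫ z, Complex.exp (τ * (‖z + v‖ ^ 2 : ℝ) * Complex.I) ∂stdComplexNormal =
      (1 - τ * Complex.I)⁻¹ *
        Complex.exp ((‖v‖ ^ 2 : ℝ) * ((1 - τ * Complex.I)⁻¹ - 1)) := by
  have hz := one_sub_ofReal_mul_I_ne_zero τ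
  have hsq (z : ℂ) : ‖z‖ ^ 2 = z.re ^ 2 + z.im ^ 2 := by
    rw [Complex.sq_norm, Complex.normSq_apply, sq, sq]
  have hsplit (p : ℝ × ℝ) : Complex.exp (τ * (‖(⟨p.1, p.2⟩ : ℂ) + v‖ ^ 2 : ℝ) * Complex.I) =
      Complex.exp (τ * (p.1 + v.re) ^ 2 * Complex.I) *
        Complex.exp (τ * (p.2 + v.im) ^ 2 * Complex.I) := by
    rw [← Complex.exp_add, hsq, Complex.add_re, Complex.add_im]
    push_cast
    ring_nf
  have hroot : (Real.pi / (1 - τ * Complex.I) : ℂ) ^ (1 / 2 : ℂ) *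
      (Real.pi / (1 - τ * Complex.I)) ^ (1 / 2 : ℂ) = Real.pi / (1 - τ * Complex.I) := by
    rw [← Complex.cpow_add _ _ (div_ne_zero (by simp [Real.pi_ne_zero]) hz), add_halves,
      Complex.cpow_one]
  have hm : Measurable fun p : ℝ × ℝ => (⟨p.1, p.2⟩ : ℂ) :=
    Complex.measurableEquivRealProd.symm.measurable
  rw [stdComplexNormal, integral_map hm.aemeasurable (by fun_prop)]
  simp_rw [hsplit]
  rw [integral_prod_mul (fun x : ℝ => Complex.exp (τ * (x + v.re) ^ 2 * Complex.I))
    (fun x : ℝ => Complex.exp (τ * (x + v.im) ^ 2 * Complex.I)),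
    integral_gaussianReal_cexp_add_sq, integral_gaussianReal_cexp_add_sq, mul_mul_mul_comm,
    ← Complex.exp_add, mul_mul_mul_comm, hroot, ← Complex.ofReal_mul, ← mul_inv,
    Real.mul_self_sqrt Real.pi_pos.le, hsq]
  push_cast
  field_simp

theorem charFun_map_norm_add_sq (Ω : ℝ) (v : ℂ) (t : ℝ) :
    charFun (stdComplexNormal.map fun z => Ω * ‖z + v‖ ^ 2) t =
      (1 - (t * Ω : ℝ) * Complex.I)⁻¹ *
        Complex.exp ((‖v‖ ^ 2 : ℝ) * ((1 - (t * Ω : ℝ) * Complex.I)⁻¹ - 1)) := by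
  rw [charFun_apply_real, integral_map (by fun_prop) (by fun_prop),
    ← integral_stdComplexNormal_cexp_norm_add_sq]
  simp only [Complex.ofReal_mul, mul_assoc]

-- The characteristic function of the mixture is `∑ e^{-m} m^n / n! * w^{n+1} = w e^{m (w - 1)}`.
theorem map_norm_add_sq_eq_sum {Ω : ℝ} (hΩ : 0 < Ω) (v : ℂ) :
    stdComplexNormal.map (fun z => Ω * ‖z + v‖ ^ 2) =
      Measure.sum fun n : ℕ => poissonMeasure (‖v‖₊ ^ 2) {n} • gammaMeasure (1 + n) (1 / Ω) := by
  have hprob (n : ℕ) : IsProbabilityMeasure (gammaMeasure (1 + n) (1 / Ω)) :=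
    isProbabilityMeasure_gammaMeasure (by positivity) (one_div_pos.2 hΩ)
  have := isProbabilityMeasure_mixture (poissonMeasure (‖v‖₊ ^ 2))
    fun n : ℕ => gammaMeasure (1 + n) (1 / Ω)
  have : IsProbabilityMeasure (stdComplexNormal.map (fun z => Ω * ‖z + v‖ ^ 2)) :=
    Measure.isProbabilityMeasure_map (by fun_prop)
  refine Measure.ext_of_charFun (funext fun t => HasSum.unique ?_ (hasSum_charFun_sum _ t))
  rw [charFun_map_norm_add_sq]
  set w : ℂ := (1 - (t * Ω : ℝ) * Complex.I)⁻¹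
  have hexp := (NormedSpace.expSeries_div_hasSum_exp ((‖v‖ ^ 2 : ℝ) * w)).mul_left
    (w * Complex.exp (-(‖v‖ ^ 2 : ℝ)))
  rw [← Complex.exp_eq_exp_ℂ, mul_assoc, ← Complex.exp_add, neg_add_eq_sub, ← mul_sub_one] at hexp
  refine hexp.congr_fun fun n => ?_
  have hgamma : charFun (gammaMeasure (1 + n) (1 / Ω)) t = w ^ (n + 1) := by
    rw [charFun_gammaMeasure_one_add_nat n (one_div_pos.2 hΩ), div_div_eq_mul_div, div_one]
  rw [charFun_apply_real, integral_smul_measure, ← charFun_apply_real, hgamma, ← measureReal_def,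
    poissonMeasure_real_singleton, Complex.real_smul]
  push_cast
  ring

theorem map_norm_sq_stdComplexNormal :
    stdComplexNormal.map (fun z => ‖z‖ ^ 2) = expMeasure 1 := by
  have hcharFun (t : ℝ) : charFun (stdComplexNormal.map fun z => ‖z‖ ^ 2) t =
      charFun (expMeasure 1) t := by
    have hnorm := charFun_map_norm_add_sq 1 0 t
    have hexp := charFun_gammaMeasure_one_add_nat 0 one_pos t
    simp only [one_mul, add_zero, norm_zero, mul_one] at hnorm
    simp only [Nat.cast_zero, add_zero, div_one, zero_add, pow_one] at hexp
    simp [hnorm, hexp, expMeasure]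
  have : IsProbabilityMeasure (stdComplexNormal.map fun z => ‖z‖ ^ 2) :=
    Measure.isProbabilityMeasure_map (by fun_prop)
  have : IsProbabilityMeasure (expMeasure 1) := isProbabilityMeasure_expMeasure one_pos
  exact Measure.ext_of_charFun (funext hcharFun)

end ComplexNormal

section NegativeMultinomial

/-- The probability of `l` under the negative multinomial law `NM(1, w)`, expressed through the odds
`q k = w k / (1 - ∑ i, w i)`, which are free to take all nonnegative values. -/
noncomputable def negMultinomial {ι : Type*} [Fintype ι] (q : ι → ℝ) (l : ι → ℕ) : ℝ :=
  (1 + ∑ k, q k)⁻¹ * ((∑ k, l k).factorial : ℝ) *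
    ∏ k, (q k * (1 + ∑ i, q i)⁻¹) ^ l k / ((l k).factorial : ℝ)

variable {ι : Type*} [Fintype ι]

theorem negMultinomial_nonneg {q : ι → ℝ} (hq : ∀ k, 0 ≤ q k) (l : ι → ℕ) :
    0 ≤ negMultinomial q l := by
  have hQ : 0 ≤ 1 + ∑ k, q k := add_nonneg zero_le_one (Finset.sum_nonneg fun k _ => hq k)
  exact mul_nonneg (mul_nonneg (inv_nonneg.2 hQ) (Nat.cast_nonneg _)) <| Finset.prod_nonneg
    fun k _ => div_nonneg (pow_nonneg (mul_nonneg (hq k) (inv_nonneg.2 hQ)) _) (Nat.cast_nonneg _)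

theorem exp_mul_prod_poisson_eq {q : ι → ℝ} (hq : 1 + ∑ k, q k ≠ 0) (l : ι → ℕ) (u : ℝ) :
    Real.exp (-u) * ∏ k, Real.exp (-(q k * u)) * (q k * u) ^ l k / (l k).factorial =
      negMultinomial q l * ((1 + ∑ k, q k) ^ (∑ k, l k + 1) / (∑ k, l k).factorial *
        u ^ (∑ k, l k) * Real.exp (-((1 + ∑ k, q k) * u))) := by
  have hn : ((∑ k, l k).factorial : ℝ) ≠ 0 := Nat.cast_ne_zero.2 (Nat.factorial_ne_zero _)
  have hexp : Real.exp (-((1 + ∑ k, q k) * u)) = Real.exp (-u) * ∏ k, Real.exp (-(q k * u)) := by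
    rw [← Real.exp_sum, ← Real.exp_add, Finset.sum_neg_distrib, ← Finset.sum_mul]
    ring_nf
  simp only [negMultinomial, hexp, mul_pow, Finset.prod_div_distrib, Finset.prod_mul_distrib,
    Finset.prod_pow_eq_pow_sum]
  rw [inv_pow]
  field_simp
  ring

theorem measurable_prod_poissonMeasure_singleton (q : ι → ℝ≥0) (l : ι → ℕ) :
    Measurable fun u : ℝ => ∏ k, poissonMeasure (q k * u.toNNReal) {l k} := by
  simp_rw [poissonMeasure_singleton]
  fun_prop

theorem lintegral_prod_poissonMeasure_expMeasure (q : ι → ℝ≥0) (l : ι → ℕ) :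
    ∫⁻ u, ∏ k, poissonMeasure (q k * u.toNNReal) {l k} ∂expMeasure 1 =
      ENNReal.ofReal (negMultinomial (fun k => q k) l) := by
  have hq (k : ι) : 0 ≤ (q k : ℝ) := (q k).2
  have hQ : 0 < 1 + ∑ k, (q k : ℝ) :=
    add_pos_of_pos_of_nonneg one_pos (Finset.sum_nonneg fun k _ => hq k)
  have hdensity (u : ℝ) : gammaPDF 1 1 u * ∏ k, poissonMeasure (q k * u.toNNReal) {l k} =
      ENNReal.ofReal (negMultinomial (fun k => q k) l) *
        gammaPDF ((∑ k, l k : ℕ) + 1) (1 + ∑ k, (q k : ℝ)) u := by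
    rcases lt_or_ge u 0 with hu | hu
    · simp only [gammaPDF_of_neg hu, zero_mul, mul_zero]
    · simp_rw [poissonMeasure_singleton]
      rw [gammaPDF_of_nonneg hu, gammaPDF_of_nonneg hu,
        ← ENNReal.ofReal_prod_of_nonneg fun k _ => by positivity,
        ← ENNReal.ofReal_mul (by positivity), ← ENNReal.ofReal_mul (negMultinomial_nonneg hq l)]
      congr 1
      rw [Real.Gamma_nat_eq_factorial, add_sub_cancel_right, Real.rpow_natCast, ← Nat.cast_succ,
        Real.rpow_natCast]
      simpa [Real.coe_toNNReal u hu] using exp_mul_prod_poisson_eq hQ.ne' l u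
  rw [expMeasure, gammaMeasure, lintegral_withDensity_eq_lintegral_mul _ (measurable_gammaPDF 1 1)
    (measurable_prod_poissonMeasure_singleton q l)]
  simp_rw [Pi.mul_apply, hdensity]
  rw [lintegral_const_mul _ (measurable_gammaPDF _ _),
    lintegral_gammaPDF_eq_one (by positivity) hQ, mul_one]

theorem hasSum_negMultinomial {K : ℕ} (q : Fin K → ℝ≥0) :
    HasSum (negMultinomial fun k => q k) 1 := by
  have hprob : IsProbabilityMeasure (expMeasure 1) := isProbabilityMeasure_expMeasure one_pos
  have htsum : ∑' l, ENNReal.ofReal (negMultinomial (fun k => q k) l) = 1 := by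
    have hpoisson (r : ℝ≥0) : ∑' n, poissonMeasure r {n} = 1 := by
      simpa using (lintegral_countable' (μ := poissonMeasure r) 1).symm
    have hprod (u : ℝ) : ∑' l : Fin K → ℕ, ∏ k, poissonMeasure (q k * u.toNNReal) {l k} = 1 := by
      simp_rw [← prod_tsum_eq_tsum_prod fun k n => poissonMeasure (q k * u.toNNReal) {n}, hpoisson,
        Finset.prod_const_one]
    simp_rw [← lintegral_prod_poissonMeasure_expMeasure]
    rw [← lintegral_tsum fun l => (measurable_prod_poissonMeasure_singleton q l).aemeasurable]
    simp_rw [hprod, lintegral_one, measure_univ]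
  have hsum := ENNReal.hasSum_toReal (htsum.trans_ne ENNReal.one_ne_top)
  rw [← ENNReal.tsum_toReal_eq fun l => ENNReal.ofReal_ne_top, htsum, ENNReal.toReal_one] at hsum
  exact hsum.congr_fun fun l =>
    (ENNReal.toReal_ofReal (negMultinomial_nonneg (fun k => (q k).2) l)).symm

end NegativeMultinomial

section CorrelatedNormal

theorem map_pi_norm_add_sq_eq_sum {K : ℕ} {Ω : Fin K → ℝ} (hΩ : ∀ k, 0 < Ω k) (v : Fin K → ℂ) :
    (Measure.pi fun _ : Fin K => stdComplexNormal).map (fun y k => Ω k * ‖y k + v k‖ ^ 2) =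
      Measure.sum fun l : Fin K → ℕ => (∏ k, poissonMeasure (‖v k‖₊ ^ 2) {l k}) •
        Measure.pi fun k => gammaMeasure (1 + l k) (1 / Ω k) := by
  have hgamma (k : Fin K) (n : ℕ) : IsProbabilityMeasure (gammaMeasure (1 + n) (1 / Ω k)) :=
    isProbabilityMeasure_gammaMeasure (by positivity) (one_div_pos.2 (hΩ k))
  have hmix (k : Fin K) := isProbabilityMeasure_mixture (poissonMeasure (‖v k‖₊ ^ 2))
    fun n : ℕ => gammaMeasure (1 + n) (1 / Ω k)
  rw [Measure.pi_map_pi (f := fun k z => Ω k * ‖z + v k‖ ^ 2) fun k => by fun_prop]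
  simp_rw [map_norm_add_sq_eq_sum (hΩ _)]
  exact pi_sum_smul _ _

variable {S : Type*} [MeasurableSpace S] {μ : Measure S} [IsProbabilityMeasure μ]

theorem map_head_tail_eq_prod_pi {K : ℕ} {E : Type*} [MeasurableSpace E] {ν : Measure E}
    [SigmaFinite ν] {α : Fin (K + 1) → S → E} (hα : ∀ i, HasLaw (α i) ν μ)
    (hind : iIndepFun α μ) :
    μ.map (fun ω => (α 0 ω, fun k : Fin K => α k.succ ω)) = ν.prod (Measure.pi fun _ => ν) := by
  have hlaw : μ.map (fun ω i => α i ω) = Measure.pi fun _ => ν := by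
    rw [(iIndepFun_iff_map_fun_eq_pi_map fun i => (hα i).aemeasurable).1 hind]
    simp_rw [(hα _).map_eq]
  rw [← (measurePreserving_piFinSuccAbove (fun _ : Fin (K + 1) => ν) 0).map_eq, ← hlaw,
    AEMeasurable.map_map_of_aemeasurable (by fun_prop)
      (aemeasurable_pi_lambda _ fun i => (hα i).aemeasurable)]
  rfl

theorem map_norm_add_mul_sq_eq_sum {K : ℕ} {α : Fin (K + 1) → S → ℂ}
    (hα : ∀ i, HasLaw (α i) stdComplexNormal μ) (hind : iIndepFun α μ) {Ω : Fin K → ℝ}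
    (hΩ : ∀ k, 0 < Ω k) (c : Fin K → ℂ) :
    μ.map (fun ω k => Ω k * ‖α k.succ ω + c k * α 0 ω‖ ^ 2) =
      Measure.sum fun l : Fin K → ℕ =>
        ENNReal.ofReal (negMultinomial (fun k => ‖c k‖ ^ 2) l) •
          Measure.pi fun k => gammaMeasure (1 + l k) (1 / Ω k) := by
  let h : ℂ × (Fin K → ℂ) → Fin K → ℝ := fun p k => Ω k * ‖p.2 k + c k * p.1‖ ^ 2
  have hh : Measurable h := by fun_prop
  have hjoint : μ.map (fun ω k => Ω k * ‖α k.succ ω + c k * α 0 ω‖ ^ 2) =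
      (stdComplexNormal.prod (Measure.pi fun _ => stdComplexNormal)).map h := by
    have hαm (i : Fin (K + 1)) : AEMeasurable (α i) μ := (hα i).aemeasurable
    rw [← map_head_tail_eq_prod_pi hα hind,
      AEMeasurable.map_map_of_aemeasurable hh.aemeasurable (by fun_prop)]
    rfl
  ext s hs
  have hslice (z : ℂ) : (Measure.pi fun _ : Fin K => stdComplexNormal) (Prod.mk z ⁻¹' (h ⁻¹' s)) =
      ∑' l : Fin K → ℕ, (∏ k, poissonMeasure (‖c k‖₊ ^ 2 * (‖z‖ ^ 2).toNNReal) {l k}) *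
        (Measure.pi fun k => gammaMeasure (1 + l k) (1 / Ω k)) s := by
    have hnorm (k : Fin K) : ‖c k * z‖₊ ^ 2 = ‖c k‖₊ ^ 2 * (‖z‖ ^ 2).toNNReal := by
      rw [nnnorm_mul, mul_pow, Real.toNNReal_pow (norm_nonneg z), norm_toNNReal]
    have hpi := congrArg (· s) (map_pi_norm_add_sq_eq_sum hΩ fun k => c k * z)
    simp_rw [hnorm, Measure.sum_apply _ hs] at hpi
    rw [Measure.map_apply (by fun_prop) hs] at hpi
    exact hpi
  have hpoisson := measurable_prod_poissonMeasure_singleton fun k => ‖c k‖₊ ^ 2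
  have hsq : Measurable fun z : ℂ => ‖z‖ ^ 2 := by fun_prop
  have hmeas (l : Fin K → ℕ) : Measurable fun z : ℂ =>
      ∏ k, poissonMeasure (‖c k‖₊ ^ 2 * (‖z‖ ^ 2).toNNReal) {l k} := (hpoisson l).comp hsq
  rw [hjoint, Measure.map_apply hh hs, Measure.prod_apply (hh hs), Measure.sum_apply _ hs]
  simp_rw [hslice]
  rw [lintegral_tsum fun l => ((hmeas l).mul_const _).aemeasurable]
  refine tsum_congr fun l => ?_
  have hweight := lintegral_prod_poissonMeasure_expMeasure (fun k => ‖c k‖₊ ^ 2) l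
  rw [← map_norm_sq_stdComplexNormal, lintegral_map (hpoisson l) hsq] at hweight
  simp only [NNReal.coe_pow, coe_nnnorm] at hweight
  rw [lintegral_mul_const _ (hmeas l), hweight, Measure.smul_apply, smul_eq_mul]

end CorrelatedNormal

section Decay

theorem norm_ofReal_cpow_neg_le_one {a : ℝ} (ha : 1 ≤ a) {s : ℂ} (hs : 0 ≤ s.re) :
    ‖(a : ℂ) ^ (-s)‖ ≤ 1 := by
  rw [Complex.norm_cpow_eq_rpow_re_of_pos (one_pos.trans_le ha)]
  exact Real.rpow_le_one_of_one_le_of_nonpos ha (neg_nonpos.2 hs)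

theorem norm_integral_ofReal_cpow_neg_le_one {Ω : Type*} [MeasurableSpace Ω] {ν : Measure Ω}
    [IsProbabilityMeasure ν] {f : Ω → ℝ} (hf : ∀ᵐ a ∂ν, 1 ≤ f a) {s : ℂ} (hs : 0 ≤ s.re) :
    ‖∫ a, (f a : ℂ) ^ (-s) ∂ν‖ ≤ 1 := by
  simpa using norm_integral_le_of_norm_le_const (μ := ν) (C := 1)
    (hf.mono fun a ha => norm_ofReal_cpow_neg_le_one ha hs)

theorem norm_mul_one_add_cpow_neg_le {s : ℂ} (hs : 0 ≤ s.re) (v : ℝ → ℂ) :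
    ∀ᵐ t ∂volume.restrict (Set.Ioi (0 : ℝ)), ‖v t * ((1 + t : ℝ) : ℂ) ^ (-s)‖ ≤ ‖v t‖ := by
  filter_upwards [ae_restrict_mem measurableSet_Ioi] with t (ht : 0 < t)
  rw [norm_mul]
  exact mul_le_of_le_one_right (norm_nonneg _)
    (norm_ofReal_cpow_neg_le_one (le_add_of_nonneg_right ht.le) hs)

theorem integrableOn_mul_one_add_cpow_neg {v : ℝ → ℂ} (hv : IntegrableOn v (Set.Ioi 0)) {s : ℂ}
    (hs : 0 ≤ s.re) :
    IntegrableOn (fun t : ℝ => v t * ((1 + t : ℝ) : ℂ) ^ (-s)) (Set.Ioi 0) :=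
  Integrable.mono hv
    (hv.aestronglyMeasurable.mul (by fun_prop : Measurable fun t : ℝ =>
      ((1 + t : ℝ) : ℂ) ^ (-s)).aestronglyMeasurable)
    (norm_mul_one_add_cpow_neg_le hs v)

theorem hasDerivAt_one_add_cpow (w : ℂ) {t : ℝ} (ht : 0 ≤ t) :
    HasDerivAt (fun t : ℝ => ((1 + t : ℝ) : ℂ) ^ w) (w * ((1 + t : ℝ) : ℂ) ^ (w - 1)) t := by
  have hinner : HasDerivAt (fun z : ℂ => 1 + z) 1 t := (hasDerivAt_id _).const_add 1
  have hslit : 1 + (t : ℂ) ∈ Complex.slitPlane := by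
    rw [← Complex.ofReal_one, ← Complex.ofReal_add, Complex.ofReal_mem_slitPlane]
    exact add_pos_of_pos_of_nonneg one_pos ht
  simpa using (hinner.cpow_const (c := w) hslit).comp_ofReal

theorem norm_mul_integral_mul_one_add_cpow_le {v v' : ℝ → ℂ}
    (hderiv : ∀ t, 0 ≤ t → HasDerivAt v (v' t) t) (hv : IntegrableOn v (Set.Ioi 0))
    (hv' : IntegrableOn v' (Set.Ioi 0)) {s : ℂ} (hs : 0 ≤ s.re) :
    ‖s * ∫ t in Set.Ioi (0 : ℝ), v t * ((1 + t : ℝ) : ℂ) ^ (-(s + 1))‖ ≤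
      ‖v 0‖ + ∫ t in Set.Ioi (0 : ℝ), ‖v' t‖ := by
  have hs' : 0 ≤ (s + 1).re := by simpa using add_nonneg hs zero_le_one
  have hint := integrableOn_mul_one_add_cpow_neg hv hs
  have hint₁ := integrableOn_mul_one_add_cpow_neg hv' hs
  have hint₂ := (integrableOn_mul_one_add_cpow_neg hv hs').const_mul s
  have hderiv' (t : ℝ) (ht : 0 ≤ t) :
      HasDerivAt (fun t : ℝ => v t * ((1 + t : ℝ) : ℂ) ^ (-s))
        (v' t * ((1 + t : ℝ) : ℂ) ^ (-s) - s * (v t * ((1 + t : ℝ) : ℂ) ^ (-(s + 1)))) t :=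
    ((hderiv t ht).mul (hasDerivAt_one_add_cpow (-s) ht)).congr_deriv (by ring_nf)
  have hlim := tendsto_zero_of_hasDerivAt_of_integrableOn_Ioi
    (fun t ht => hderiv' t (le_of_lt ht)) (hint₁.sub hint₂) hint
  have hparts : s * ∫ t in Set.Ioi (0 : ℝ), v t * ((1 + t : ℝ) : ℂ) ^ (-(s + 1)) =
      v 0 + ∫ t in Set.Ioi (0 : ℝ), v' t * ((1 + t : ℝ) : ℂ) ^ (-s) := by
    have h := integral_Ioi_of_hasDerivAt_of_tendsto' (fun t ht => hderiv' t ht)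
      (hint₁.sub hint₂) hlim
    rw [integral_sub hint₁ hint₂, integral_const_mul, add_zero, Complex.ofReal_one,
      Complex.one_cpow, mul_one] at h
    linear_combination -h
  rw [hparts]
  exact (norm_add_le _ _).trans (add_le_add_right
    (norm_integral_le_of_norm_le hv'.norm (norm_mul_one_add_cpow_neg_le hs v')) _)

theorem integrableOn_polynomial_mul_cexp_neg_mul (p : Polynomial ℂ) {r : ℂ} (hr : 0 < r.re) :
    IntegrableOn (fun t : ℝ => p.eval (t : ℂ) * Complex.exp (-r * t)) (Set.Ioi 0) := by
  induction p using Polynomial.induction_on' with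
  | add p q hp hq =>
    simp only [Polynomial.eval_add, add_mul]
    exact hp.add hq
  | monomial n a =>
    simp only [Polynomial.eval_monomial, mul_assoc]
    exact (integrableOn_pow_mul_cexp_neg_mul n hr).const_mul a

theorem exists_norm_mul_integral_pow_mul_cexp_le (n : ℕ) {r : ℂ} (hr : 0 < r.re) :
    ∃ D : ℝ, ∀ s : ℂ, 0 ≤ s.re → ‖s * ∫ t in Set.Ioi (0 : ℝ),
      (t : ℂ) ^ n * Complex.exp (-r * t) * ((1 + t : ℝ) : ℂ) ^ (-s)‖ ≤ D := by
  let p : Polynomial ℂ := (1 + Polynomial.X) * Polynomial.X ^ n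
  let v' (t : ℝ) : ℂ := (p.derivative - Polynomial.C r * p).eval (t : ℂ) *
    Complex.exp (-r * t)
  have hderiv (t : ℝ) :
      HasDerivAt (fun t : ℝ => p.eval (t : ℂ) * Complex.exp (-r * t)) (v' t) t := by
    refine HasDerivAt.comp_ofReal (e := fun z : ℂ => p.eval z * Complex.exp (-r * z)) <|
      ((p.hasDerivAt _).mul ((hasDerivAt_id (t : ℂ)).const_mul (-r)).cexp).congr_deriv ?_
    simp only [v', Polynomial.eval_sub, Polynomial.eval_mul, Polynomial.eval_C, id_eq]
    ring
  refine ⟨‖p.eval ((0 : ℝ) : ℂ) * Complex.exp (-r * (0 : ℝ))‖ +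
    ∫ t in Set.Ioi (0 : ℝ), ‖v' t‖, fun s hs => ?_⟩
  convert norm_mul_integral_mul_one_add_cpow_le (fun t _ => hderiv t)
    (integrableOn_polynomial_mul_cexp_neg_mul p hr)
    (integrableOn_polynomial_mul_cexp_neg_mul _ hr) hs using 3
  refine setIntegral_congr_fun measurableSet_Ioi fun t (ht : 0 < t) => ?_
  have ht1 : ((1 + t : ℝ) : ℂ) ≠ 0 := Complex.ofReal_ne_zero.2 (add_pos one_pos ht).ne'
  have hcpow : ((1 + t : ℝ) : ℂ) ^ (-s) = ((1 + t : ℝ) : ℂ) * ((1 + t : ℝ) : ℂ) ^ (-(s + 1)) := by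
    rw [neg_add, Complex.cpow_add _ _ ht1, Complex.cpow_neg_one, mul_left_comm,
      mul_inv_cancel₀ ht1, mul_one]
  simp only [hcpow, p, Polynomial.eval_mul, Polynomial.eval_add, Polynomial.eval_one,
    Polynomial.eval_X, Polynomial.eval_pow]
  push_cast
  ring

theorem exists_norm_mul_integral_gammaMeasure_le (n : ℕ) {r : ℝ} (hr : 0 < r) :
    ∃ D : ℝ, ∀ s : ℂ, 0 ≤ s.re →
      ‖s * ∫ x, ((1 + x : ℝ) : ℂ) ^ (-s) ∂gammaMeasure (1 + n) r‖ ≤ D := by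
  obtain ⟨D, hD⟩ := exists_norm_mul_integral_pow_mul_cexp_le n (r := r) (by simpa using hr)
  refine ⟨‖((r ^ (1 + n : ℝ) / Real.Gamma (1 + n) : ℝ) : ℂ)‖ * D, fun s hs => ?_⟩
  rw [integral_gammaMeasure (by positivity) hr, mul_left_comm, norm_mul]
  simp only [add_sub_cancel_left, Real.rpow_natCast, Complex.ofReal_mul, Complex.ofReal_pow,
    Complex.ofReal_exp, Complex.ofReal_neg]
  exact mul_le_mul_of_nonneg_left (hD s hs) (norm_nonneg _)

end Decay

section Mellin

theorem integral_norm_cpow_smul_comp_mul_left (f : ℝ → ℂ) (s : ℂ) {a : ℝ} (ha : 0 < a) :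
    ∫ z in Set.Ioi (0 : ℝ), ‖(z : ℂ) ^ (s - 1) • f (a * z)‖ =
      ‖(a : ℂ) ^ (-s)‖ * ∫ z in Set.Ioi (0 : ℝ), ‖(z : ℂ) ^ (s - 1) • f z‖ := by
  have ha0 : (a : ℂ) ≠ 0 := Complex.ofReal_ne_zero.2 ha.ne'
  have hscale : ∀ z ∈ Set.Ioi (0 : ℝ), ‖(z : ℂ) ^ (s - 1) • f (a * z)‖ =
      ‖(a : ℂ) ^ (1 - s)‖ * ‖((a * z : ℝ) : ℂ) ^ (s - 1) • f (a * z)‖ := fun z hz => by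
    rw [← norm_mul, smul_eq_mul, smul_eq_mul, Complex.ofReal_mul,
      Complex.mul_cpow_ofReal_nonneg ha.le (le_of_lt hz), ← mul_assoc, ← mul_assoc,
      ← Complex.cpow_add _ _ ha0, sub_add_sub_cancel', sub_self, Complex.cpow_zero, one_mul]
  rw [setIntegral_congr_fun measurableSet_Ioi hscale, integral_const_mul,
    integral_comp_mul_left_Ioi (fun z : ℝ => ‖(z : ℂ) ^ (s - 1) • f z‖) 0 ha, mul_zero, smul_eq_mul,
    ← mul_assoc, sub_eq_add_neg, Complex.cpow_add _ _ ha0, Complex.cpow_one, norm_mul,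
    Complex.norm_real, Real.norm_of_nonneg ha.le]
  field_simp

theorem hasMellin_congr {f g : ℝ → ℂ} {s m : ℂ} (hfg : Set.EqOn f g (Set.Ioi 0))
    (hf : HasMellin f s m) : HasMellin g s m := by
  have hsmul : Set.EqOn (fun t : ℝ => (t : ℂ) ^ (s - 1) • f t) (fun t => (t : ℂ) ^ (s - 1) • g t)
      (Set.Ioi 0) := fun t ht => congrArg _ (hfg ht)
  exact ⟨hf.1.congr_fun hsmul measurableSet_Ioi,
    (setIntegral_congr_fun measurableSet_Ioi hsmul).symm.trans hf.2⟩

theorem hasMellin_integral_comp_mul_left {ν : Measure ℝ} [SFinite ν] (hν : ∀ᵐ a ∂ν, 0 < a)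
    {f : ℝ → ℂ} (hfm : Measurable f) {s : ℂ} (hf : MellinConvergent f s)
    (hs : Integrable (fun a : ℝ => (a : ℂ) ^ (-s)) ν) :
    HasMellin (fun z => ∫ a, f (a * z) ∂ν) s ((∫ a, (a : ℂ) ^ (-s) ∂ν) * mellin f s) := by
  have hint : Integrable (fun p : ℝ × ℝ => (p.1 : ℂ) ^ (s - 1) • f (p.2 * p.1))
      ((volume.restrict (Set.Ioi 0)).prod ν) := by
    refine (integrable_prod_iff' (by fun_prop)).2 ⟨hν.mono fun a ha => ?_, ?_⟩
    · exact (MellinConvergent.comp_mul_left ha).2 hf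
    · refine (hs.norm.mul_const (∫ z in Set.Ioi (0 : ℝ), ‖(z : ℂ) ^ (s - 1) • f z‖)).congr
        (hν.mono fun a ha => ?_)
      exact (integral_norm_cpow_smul_comp_mul_left f s ha).symm
  refine ⟨?_, ?_⟩
  · simpa only [MellinConvergent, IntegrableOn, integral_smul] using hint.integral_prod_left
  · simp_rw [mellin, ← integral_smul]
    rw [integral_integral_swap hint, ← integral_mul_const]
    exact integral_congr_ae (hν.mono fun a ha => mellin_comp_mul_left f s ha)

theorem integrable_ofReal_cpow_neg {ν : Measure ℝ} [IsFiniteMeasure ν] (hν : ∀ᵐ a ∂ν, 1 ≤ a)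
    {s : ℂ} (hs : 0 ≤ s.re) : Integrable (fun a : ℝ => (a : ℂ) ^ (-s)) ν :=
  .of_bound (by fun_prop : Measurable fun a : ℝ => (a : ℂ) ^ (-s)).aestronglyMeasurable 1
    (hν.mono fun _ ha => norm_ofReal_cpow_neg_le_one ha hs)

theorem hasMellin_cdf_div {ν : Measure ℝ} [IsProbabilityMeasure ν] (hν : ∀ᵐ a ∂ν, 1 ≤ a)
    {M : ℝ} (hM : 0 < M) {s : ℂ} (hs : 0 < s.re) :
    HasMellin (fun z => ((cdf ν (M / z) : ℝ) : ℂ)) s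
      ((M : ℂ) ^ s * (∫ a, (a : ℂ) ^ (-s) ∂ν) / s) := by
  let f : ℝ → ℂ := fun z => (Set.Ioc 0 1).indicator (fun _ => 1) (M⁻¹ * z)
  have hfm : Measurable f :=
    (measurable_const.indicator measurableSet_Ioc).comp (measurable_const_mul M⁻¹)
  have hmellin : mellin f s = (M : ℂ) ^ s / s := by
    rw [mellin_comp_mul_left _ _ (inv_pos.2 hM), (hasMellin_one_Ioc hs).2, Complex.ofReal_inv,
      Complex.inv_cpow_ofReal_nonneg hM.le, Complex.cpow_neg, inv_inv, smul_eq_mul, mul_one_div]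
  have hcdf : ∀ z ∈ Set.Ioi (0 : ℝ), ∫ a, f (a * z) ∂ν = (cdf ν (M / z) : ℝ) := by
    intro z (hz : 0 < z)
    have hind : (fun a => f (a * z)) =ᵐ[ν] (Set.Iic (M / z)).indicator fun _ => 1 :=
      hν.mono fun a ha => by
        have hpos : 0 < M⁻¹ * (a * z) :=
          mul_pos (inv_pos.2 hM) (mul_pos (one_pos.trans_le ha) hz)
        simp only [f, Set.indicator, Set.mem_Ioc, hpos, true_and, Set.mem_Iic, le_div_iff₀ hz,
          inv_mul_le_one₀ hM]
    rw [integral_congr_ae hind, integral_indicator_const _ measurableSet_Iic, cdf_eq_real,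
      Complex.real_smul, mul_one]
  have h := hasMellin_integral_comp_mul_left (hν.mono fun a ha => one_pos.trans_le ha) hfm
    ((MellinConvergent.comp_mul_left (inv_pos.2 hM)).2 (hasMellin_one_Ioc hs).1)
    (integrable_ofReal_cpow_neg hν hs.le)
  rw [hmellin, mul_div_left_comm, ← mul_div_assoc] at h
  exact hasMellin_congr hcdf h

theorem continuous_integral_ofReal_cpow_neg {ν : Measure ℝ} [IsFiniteMeasure ν]
    (hν : ∀ᵐ a ∂ν, 1 ≤ a) {c : ℝ} (hc : 0 ≤ c) :
    Continuous fun y : ℝ => ∫ a, (a : ℂ) ^ (-(c + y * Complex.I : ℂ)) ∂ν := by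
  refine continuous_of_dominated (bound := fun _ => (1 : ℝ))
    (fun y => (by fun_prop : Measurable fun a : ℝ =>
      (a : ℂ) ^ (-(c + y * Complex.I : ℂ))).aestronglyMeasurable)
    (fun y => hν.mono fun a ha => norm_ofReal_cpow_neg_le_one ha (by simpa using hc))
    (integrable_const _) (hν.mono fun a ha => ?_)
  exact Continuous.const_cpow (by fun_prop)
    (Or.inl (Complex.ofReal_ne_zero.2 (one_pos.trans_le ha).ne'))

theorem verticalIntegrable_of_norm_sq_mul_le {f : ℂ → ℂ} {c D : ℝ} (hc : c ≠ 0)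
    (hf : Continuous fun y : ℝ => f (c + y * Complex.I))
    (hD : ∀ s : ℂ, s.re = c → ‖s ^ 2 * f s‖ ≤ D) : Complex.VerticalIntegrable f c := by
  have hbound : Integrable fun y : ℝ => D / c ^ 2 * (1 + (y / c) ^ 2)⁻¹ :=
    (integrable_inv_one_add_sq.comp_div hc).const_mul _
  refine hbound.mono' hf.aestronglyMeasurable (ae_of_all _ fun y => ?_)
  have hnorm : ‖(c + y * Complex.I : ℂ) ^ 2‖ = c ^ 2 * (1 + (y / c) ^ 2) := by
    rw [norm_pow, Complex.sq_norm, Complex.normSq_add_mul_I]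
    field_simp
  have h := hD (c + y * Complex.I) (by simp)
  rw [norm_mul, hnorm] at h
  rw [← div_eq_mul_inv, div_div, le_div_iff₀ (by positivity), mul_comm]
  exact h

theorem mellinInv_eq_of_hasMellin {c : ℝ} {f : ℝ → ℂ} {F : ℂ → ℂ}
    (hF : ∀ s : ℂ, s.re = c → HasMellin f s (F s)) (hv : Complex.VerticalIntegrable F c)
    {x : ℝ} (hx : 0 < x) (hfx : ContinuousAt f x) : mellinInv c F x = f x := by
  have hline (y : ℝ) : mellin f (c + y * Complex.I) = F (c + y * Complex.I) :=
    (hF _ (by simp)).2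
  rw [← mellinInv_mellin_eq c f hx (hF c (Complex.ofReal_re c)).1 _ hfx]
  · simp only [mellinInv, hline]
  · simpa only [Complex.VerticalIntegrable, hline] using hv

end Mellin

section Fox

theorem prod_ofReal_cpow {ι : Type*} (t : Finset ι) {f : ι → ℝ} (hf : ∀ i ∈ t, 0 ≤ f i) (s : ℂ) :
    ((∏ i ∈ t, f i : ℝ) : ℂ) ^ s = ∏ i ∈ t, (f i : ℂ) ^ s := by
  induction t using Finset.cons_induction with
  | empty => simp
  | cons a t ha ih =>
    obtain ⟨hfa, hft⟩ := Finset.forall_mem_cons ha _ |>.1 hf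
    rw [Finset.prod_cons, Finset.prod_cons, Complex.ofReal_mul,
      Complex.mul_cpow_ofReal_nonneg hfa (Finset.prod_nonneg hft), ih hft]

theorem foxXi_eq_integral_gammaMeasure {A φ : ℝ} (hA : 0 < A) (hφ : 0 < φ) (s : ℂ) :
    foxXi 1 (-1) A φ s = (A : ℂ) ^ (-s) * ∫ r, ((1 + r : ℝ) : ℂ) ^ (-s) ∂gammaMeasure φ A := by
  have hA0 : (A : ℂ) ≠ 0 := Complex.ofReal_ne_zero.2 hA.ne'
  have hpow : (A : ℂ) ^ ((φ : ℂ) + (1 : ℝ) + (-1 : ℝ) * s - 1) =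
      (A : ℂ) ^ (-s) * ((A ^ φ : ℝ) : ℂ) := by
    rw [Complex.ofReal_cpow hA.le, ← Complex.cpow_add _ _ hA0]
    push_cast
    ring_nf
  have hexp : (φ : ℂ) + (1 : ℝ) + (-1 : ℝ) * s - φ - 1 = -s := by
    push_cast
    ring
  have hintegrand : ∀ t ∈ Set.Ioi (0 : ℝ),
      Complex.exp (-A * t) * (t : ℂ) ^ ((φ : ℂ) - 1) * (1 + (t : ℂ)) ^ (-s) =
        ((t ^ (φ - 1) * Real.exp (-A * t) : ℝ) : ℂ) * ((1 + t : ℝ) : ℂ) ^ (-s) := by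
    intro t (ht : 0 < t)
    rw [Complex.ofReal_mul, Complex.ofReal_cpow ht.le]
    push_cast
    ring
  rw [foxXi, if_neg hA.ne', tricomi, hpow, hexp, setIntegral_congr_fun measurableSet_Ioi hintegrand,
    integral_gammaMeasure hφ hA, Complex.ofReal_div, Complex.Gamma_ofReal]
  ring

end Fox

namespace Channel

variable {K : ℕ} (C : Channel K)

section Parameters

theorem expo_pos (hδ : 0 < C.δ) (k : Fin K) : 0 < C.expo k := by
  rw [expo, Nat.cast_succ, add_sub_right_comm, add_sub_cancel_right]
  exact add_pos_of_nonneg_of_pos (Nat.cast_nonneg _) hδ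

theorem rpow_two_mul_expo (hρδ : 0 ≤ C.ρ ∨ ∃ d : ℕ, C.δ = d) (k : Fin K) :
    C.ρ ^ (2 * C.expo k) = (C.ρ ^ C.expo k) ^ 2 := by
  rcases hρδ with hρ | ⟨d, hd⟩
  · rw [mul_comm, ← Nat.cast_two, Real.rpow_mul_natCast hρ]
  · have hexpo : C.expo k = (k + d : ℕ) := by
      rw [expo, hd, Nat.cast_succ, add_sub_right_comm, add_sub_cancel_right, Nat.cast_add]
    rw [hexpo, ← Nat.cast_two, ← Nat.cast_mul, Real.rpow_natCast, Real.rpow_natCast, mul_comm,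
      pow_mul]

theorem rpow_two_mul_expo_lt_one (hρ : |C.ρ| < 1) (hδ : 0 < C.δ) (k : Fin K) :
    C.ρ ^ (2 * C.expo k) < 1 :=
  calc C.ρ ^ (2 * C.expo k) ≤ |C.ρ| ^ (2 * C.expo k) :=
        (le_abs_self _).trans (Real.abs_rpow_le_abs_rpow _ _)
    _ < 1 := Real.rpow_lt_one (abs_nonneg _) hρ (mul_pos two_pos (C.expo_pos hδ k))

theorem scale_pos (hP : ∀ k, 0 < C.P k) (hσ : ∀ k, C.σ k ≠ 0) (hρ : |C.ρ| < 1) (hδ : 0 < C.δ)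
    (k : Fin K) : 0 < C.scale k :=
  mul_pos (mul_pos (hP k) (even_two.pow_pos (hσ k)))
    (sub_pos.2 (C.rpow_two_mul_expo_lt_one hρ hδ k))

/-- The coefficient of `α 0` relative to that of `α k` in `h_k`. -/
noncomputable def relCoeff (k : Fin K) : ℝ := C.ρ ^ C.expo k / √(1 - C.ρ ^ (2 * C.expo k))

theorem odds_eq_sq_relCoeff (hρ : |C.ρ| < 1) (hδ : 0 < C.δ)
    (hρδ : 0 ≤ C.ρ ∨ ∃ d : ℕ, C.δ = d) (k : Fin K) : C.odds k = C.relCoeff k ^ 2 := by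
  rw [odds, relCoeff, div_pow, Real.sq_sqrt (sub_pos.2 (C.rpow_two_mul_expo_lt_one hρ hδ k)).le,
    C.rpow_two_mul_expo hρδ]

theorem weight_eq_negMultinomial (hρ : |C.ρ| < 1) (hδ : 0 < C.δ)
    (hρδ : 0 ≤ C.ρ ∨ ∃ d : ℕ, C.δ = d) :
    C.weight = negMultinomial fun k => ‖(C.relCoeff k : ℂ)‖ ^ 2 := by
  have hodds : C.odds = fun k => ‖(C.relCoeff k : ℂ)‖ ^ 2 := funext fun k => by
    rw [C.odds_eq_sq_relCoeff hρ hδ hρδ, Complex.norm_real, Real.norm_eq_abs, sq_abs]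
  rw [← hodds]
  rfl

theorem weight_nonneg (hρ : |C.ρ| < 1) (hδ : 0 < C.δ) (hρδ : 0 ≤ C.ρ ∨ ∃ d : ℕ, C.δ = d)
    (l : Fin K → ℕ) : 0 ≤ C.weight l := by
  rw [C.weight_eq_negMultinomial hρ hδ hρδ]
  exact negMultinomial_nonneg (fun k => sq_nonneg _) l

theorem hasSum_weight (hρ : |C.ρ| < 1) (hδ : 0 < C.δ) (hρδ : 0 ≤ C.ρ ∨ ∃ d : ℕ, C.δ = d) :
    HasSum C.weight 1 := by
  rw [C.weight_eq_negMultinomial hρ hδ hρδ]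
  have hsum := hasSum_negMultinomial fun k => ‖(C.relCoeff k : ℂ)‖₊ ^ 2
  simpa only [NNReal.coe_pow, coe_nnnorm] using hsum

end Parameters

section SNR

variable {S : Type*} (α : Fin (K + 1) → S → ℂ)

theorem snr_eq_scale_mul (hρ : |C.ρ| < 1) (hδ : 0 < C.δ) (k : Fin K) (ω : S) :
    C.snr α k ω = C.scale k * ‖α k.succ ω + C.relCoeff k * α 0 ω‖ ^ 2 := by
  have hpos := sub_pos.2 (C.rpow_two_mul_expo_lt_one hρ hδ k)
  have hsqrt : ((√(1 - C.ρ ^ (2 * C.expo k)) : ℝ) : ℂ) ≠ 0 :=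
    Complex.ofReal_ne_zero.2 (Real.sqrt_pos.2 hpos).ne'
  have hcoeff : C.coeff α k ω = (C.σ k * √(1 - C.ρ ^ (2 * C.expo k)) : ℝ) *
      (α k.succ ω + C.relCoeff k * α 0 ω) := by
    rw [coeff, relCoeff]
    push_cast
    field_simp
  rw [snr, hcoeff, norm_mul, mul_pow, Complex.norm_real, Real.norm_eq_abs, sq_abs, mul_pow,
    Real.sq_sqrt hpos.le, scale]
  ring

end SNR

section Laws

theorem isProbabilityMeasure_gamma_scale (hC : ∀ k, 0 < C.scale k) (l : Fin K → ℕ) (k : Fin K) :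
    IsProbabilityMeasure (gammaMeasure (1 + l k) (1 / C.scale k)) :=
  isProbabilityMeasure_gammaMeasure (by positivity) (one_div_pos.2 (hC k))

theorem ae_pi_gamma_scale_pos (hC : ∀ k, 0 < C.scale k) (l : Fin K → ℕ) :
    ∀ᵐ r ∂Measure.pi fun k => gammaMeasure (1 + l k) (1 / C.scale k), ∀ k, 0 < r k := by
  have := C.isProbabilityMeasure_gamma_scale hC l
  exact ae_all_iff.2 fun k => Measure.tendsto_eval_ae_ae.eventually (ae_gammaMeasure_pos _ _)

theorem isProbabilityMeasure_shiftedGammaProd (hC : ∀ k, 0 < C.scale k) (l : Fin K → ℕ) :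
    IsProbabilityMeasure (C.shiftedGammaProd l) := by
  have := C.isProbabilityMeasure_gamma_scale hC l
  exact Measure.isProbabilityMeasure_map measurable_prod_one_add.aemeasurable

theorem ae_one_le_shiftedGammaProd (hC : ∀ k, 0 < C.scale k) (l : Fin K → ℕ) :
    ∀ᵐ x ∂C.shiftedGammaProd l, 1 ≤ x := by
  have := C.isProbabilityMeasure_gamma_scale hC l
  rw [shiftedGammaProd, ae_map_iff measurable_prod_one_add.aemeasurable measurableSet_Ici]
  exact (C.ae_pi_gamma_scale_pos hC l).mono fun r hr =>
    Finset.one_le_prod fun k _ => le_add_of_nonneg_right (hr k).le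

theorem shiftedGammaProd_absolutelyContinuous [NeZero K] (hC : ∀ k, 0 < C.scale k)
    (l : Fin K → ℕ) : C.shiftedGammaProd l ≪ volume := by
  have := C.isProbabilityMeasure_gamma_scale hC l
  exact absolutelyContinuous_map_pi_prod_one_add
    (fun k => (ae_gammaMeasure_pos _ _).mono fun x hx => (add_pos one_pos hx).ne')
    (absolutelyContinuous_gammaMeasure _ _ : gammaMeasure (1 + l 0) (1 / C.scale 0) ≪ volume)

variable {S : Type*} [MeasurableSpace S] {μ : Measure S} {α : Fin (K + 1) → S → ℂ}

theorem aemeasurable_G (hα : ∀ i, AEMeasurable (α i) μ) : AEMeasurable (C.G α) μ := by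
  unfold G snr coeff
  fun_prop

variable [IsProbabilityMeasure μ]

theorem map_G_eq_sum (hC : ∀ k, 0 < C.scale k) (hρ : |C.ρ| < 1) (hδ : 0 < C.δ)
    (hρδ : 0 ≤ C.ρ ∨ ∃ d : ℕ, C.δ = d) (hα : ∀ i, HasLaw (α i) stdComplexNormal μ)
    (hind : iIndepFun α μ) :
    μ.map (C.G α) = Measure.sum fun l => ENNReal.ofReal (C.weight l) • C.shiftedGammaProd l := by
  have hαm (i : Fin (K + 1)) : AEMeasurable (α i) μ := (hα i).aemeasurable
  have hG : C.G α = (fun r : Fin K → ℝ => ∏ k, (1 + r k)) ∘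
      fun ω k => C.scale k * ‖α k.succ ω + C.relCoeff k * α 0 ω‖ ^ 2 :=
    funext fun ω => by simp only [G, C.snr_eq_scale_mul α hρ hδ, Function.comp_apply]
  rw [hG, ← AEMeasurable.map_map_of_aemeasurable measurable_prod_one_add.aemeasurable (by fun_prop),
    map_norm_add_mul_sq_eq_sum hα hind hC, Measure.map_sum measurable_prod_one_add.aemeasurable]
  simp_rw [Measure.map_smul, C.weight_eq_negMultinomial hρ hδ hρδ, shiftedGammaProd]

theorem map_G_absolutelyContinuous [NeZero K] (hC : ∀ k, 0 < C.scale k) (hρ : |C.ρ| < 1)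
    (hδ : 0 < C.δ) (hρδ : 0 ≤ C.ρ ∨ ∃ d : ℕ, C.δ = d) (hα : ∀ i, HasLaw (α i) stdComplexNormal μ)
    (hind : iIndepFun α μ) : μ.map (C.G α) ≪ volume := by
  rw [C.map_G_eq_sum hC hρ hδ hρδ hα hind]
  exact Measure.absolutelyContinuous_sum_left fun l =>
    (C.shiftedGammaProd_absolutelyContinuous hC l).smul_left _

theorem hasSum_weight_mul_cdf (hC : ∀ k, 0 < C.scale k) (hρ : |C.ρ| < 1) (hδ : 0 < C.δ)
    (hρδ : 0 ≤ C.ρ ∨ ∃ d : ℕ, C.δ = d) (hα : ∀ i, HasLaw (α i) stdComplexNormal μ)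
    (hind : iIndepFun α μ) (x : ℝ) :
    HasSum (fun l => C.weight l * cdf (C.shiftedGammaProd l) x) (cdf (μ.map (C.G α)) x) := by
  have := C.isProbabilityMeasure_shiftedGammaProd hC
  have hprob := Measure.isProbabilityMeasure_map (C.aemeasurable_G fun i => (hα i).aemeasurable)
  simp_rw [cdf_eq_real]
  rw [C.map_G_eq_sum hC hρ hδ hρδ hα hind] at hprob ⊢
  exact hasSum_mul_measureReal (C.weight_nonneg hρ hδ hρδ) _ measurableSet_Iic

end Laws

section FoxFunction

theorem integral_cpow_shiftedGammaProd (hC : ∀ k, 0 < C.scale k) (l : Fin K → ℕ) (s : ℂ) :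
    ∫ a, (a : ℂ) ^ (-s) ∂C.shiftedGammaProd l =
      ∏ k, ∫ r, ((1 + r : ℝ) : ℂ) ^ (-s) ∂gammaMeasure (1 + l k) (1 / C.scale k) := by
  have := C.isProbabilityMeasure_gamma_scale hC l
  rw [shiftedGammaProd, integral_map measurable_prod_one_add.aemeasurable
      (by fun_prop : Measurable fun a : ℝ => (a : ℂ) ^ (-s)).aestronglyMeasurable,
    ← integral_fintype_prod_eq_prod fun _ (r : ℝ) => ((1 + r : ℝ) : ℂ) ^ (-s)]
  exact integral_congr_ae ((C.ae_pi_gamma_scale_pos hC l).mono fun r hr =>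
    prod_ofReal_cpow _ (fun k _ => (add_pos one_pos (hr k)).le) _)

theorem exists_norm_mul_integral_shiftedGammaProd_le [NeZero K] (hC : ∀ k, 0 < C.scale k)
    (l : Fin K → ℕ) : ∃ D : ℝ, ∀ s : ℂ, 0 ≤ s.re →
      ‖s * ∫ a, (a : ℂ) ^ (-s) ∂C.shiftedGammaProd l‖ ≤ D := by
  have := C.isProbabilityMeasure_gamma_scale hC l
  obtain ⟨D, hD⟩ := exists_norm_mul_integral_gammaMeasure_le (l 0) (one_div_pos.2 (hC 0))
  refine ⟨D, fun s hs => ?_⟩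
  rw [C.integral_cpow_shiftedGammaProd hC, ← Finset.mul_prod_erase _ _ (Finset.mem_univ 0),
    ← mul_assoc, norm_mul, norm_prod]
  refine (mul_le_of_le_one_right (norm_nonneg _) ?_).trans (hD s hs)
  exact Finset.prod_le_one (fun _ _ => norm_nonneg _) fun k _ =>
    norm_integral_ofReal_cpow_neg_le_one
      ((ae_gammaMeasure_pos _ _).mono fun x hx => le_add_of_nonneg_right hx.le) hs

theorem foxKernel_eq (hC : ∀ k, 0 < C.scale k) (l : Fin K → ℕ) {s : ℂ} (hs : 0 < s.re) :
    foxKernel 1 K (C.foxUp l) foxLow s =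
      ((∏ k, C.scale k : ℝ) : ℂ) ^ s * (∫ a, (a : ℂ) ^ (-s) ∂C.shiftedGammaProd l) / s := by
  have hs0 : s ≠ 0 := by
    rintro rfl
    exact hs.ne' Complex.zero_re
  have hup (k : Fin K) : foxXi (1 - 0) (-1) (1 / C.scale k) (1 + l k) s =
      (C.scale k : ℂ) ^ s *
        ∫ r, ((1 + r : ℝ) : ℂ) ^ (-s) ∂gammaMeasure (1 + l k) (1 / C.scale k) := by
    rw [sub_zero, foxXi_eq_integral_gammaMeasure (one_div_pos.2 (hC k)) (by positivity), one_div,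
      Complex.ofReal_inv, Complex.inv_cpow_ofReal_nonneg (hC k).le, Complex.cpow_neg, inv_inv]
  have hGamma : foxXi 0 1 0 1 s * (foxXi 1 1 0 1 s)⁻¹ = s⁻¹ := by
    have h1 : (1 + 1 + s - 1 : ℂ) = s + 1 := by ring
    simp only [foxXi, if_true, Complex.ofReal_one, Complex.ofReal_zero, Complex.Gamma_one, div_one,
      one_mul, add_zero, add_sub_cancel_left, h1, Complex.Gamma_add_one s hs0]
    rw [mul_inv, mul_left_comm, mul_inv_cancel₀ (Complex.Gamma_ne_zero_of_re_pos hs), mul_one]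
  rw [foxKernel, Fin.prod_univ_castSucc (n := K), Fin.prod_univ_one]
  simp only [foxUp, foxLow, Fin.snoc_castSucc, Fin.snoc_last, Fin.val_castSucc, Fin.is_lt, if_true,
    Fin.val_last, lt_irrefl, if_false, Fin.val_zero, zero_lt_one, hup]
  rw [Finset.prod_mul_distrib, ← prod_ofReal_cpow _ fun k _ => (hC k).le,
    ← C.integral_cpow_shiftedGammaProd hC, mul_left_comm, hGamma, div_eq_mul_inv]

theorem hasMellin_cdf_shiftedGammaProd (hC : ∀ k, 0 < C.scale k) (l : Fin K → ℕ) {s : ℂ}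
    (hs : 0 < s.re) :
    HasMellin (fun z => ((cdf (C.shiftedGammaProd l) ((∏ k, C.scale k) / z) : ℝ) : ℂ)) s
      (foxKernel 1 K (C.foxUp l) foxLow s) := by
  have := C.isProbabilityMeasure_shiftedGammaProd hC l
  rw [C.foxKernel_eq hC l hs]
  exact hasMellin_cdf_div (C.ae_one_le_shiftedGammaProd hC l)
    (Finset.prod_pos fun k _ => hC k) hs

theorem verticalIntegrable_foxKernel [NeZero K] (hC : ∀ k, 0 < C.scale k) (l : Fin K → ℕ) {c : ℝ}
    (hc : 0 < c) : Complex.VerticalIntegrable (foxKernel 1 K (C.foxUp l) foxLow) c := by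
  have := C.isProbabilityMeasure_shiftedGammaProd hC l
  have hM : 0 < ∏ k, C.scale k := Finset.prod_pos fun k _ => hC k
  have hne (s : ℂ) (hs : s.re = c) : s ≠ 0 := by
    rintro rfl
    exact hc.ne hs
  obtain ⟨D, hD⟩ := C.exists_norm_mul_integral_shiftedGammaProd_le hC l
  refine verticalIntegrable_of_norm_sq_mul_le (D := (∏ k, C.scale k) ^ c * D) hc.ne' ?_
    fun s hs => ?_
  · simp_rw [fun y : ℝ => C.foxKernel_eq hC l (s := c + y * Complex.I) (by simpa using hc)]
    refine Continuous.div (.mul (.const_cpow (by fun_prop) (.inl ?_)) ?_) (by fun_prop)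
      fun y => hne _ (by simp)
    · exact Complex.ofReal_ne_zero.2 hM.ne'
    · exact continuous_integral_ofReal_cpow_neg (C.ae_one_le_shiftedGammaProd hC l) hc.le
  · have hre : 0 < s.re := hs ▸ hc
    rw [C.foxKernel_eq hC l hre, sq, mul_assoc, mul_div_cancel₀ _ (hne s hs), mul_left_comm,
      norm_mul, Complex.norm_cpow_eq_rpow_re_of_pos hM, hs]
    exact mul_le_mul_of_nonneg_left (hD s hre.le) (Real.rpow_nonneg hM.le c)

theorem cdf_eq_foxY [NeZero K] (hC : ∀ k, 0 < C.scale k) (l : Fin K → ℕ) {c : ℝ} (hc : 0 < c)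
    {x : ℝ} (hx : 0 < x) :
    ((cdf (C.shiftedGammaProd l) x : ℝ) : ℂ) =
      foxY c 1 K (C.foxUp l) foxLow ((∏ k, C.scale k) / x) := by
  have := C.isProbabilityMeasure_shiftedGammaProd hC l
  have hac := C.shiftedGammaProd_absolutelyContinuous hC l
  have hM : 0 < ∏ k, C.scale k := Finset.prod_pos fun k _ => hC k
  have hMx := div_pos hM hx
  have : NullSingletonClass (C.shiftedGammaProd l) := ⟨fun y => hac (measure_singleton y)⟩
  rw [foxY, mellinInv_eq_of_hasMellin
    (fun s hs => C.hasMellin_cdf_shiftedGammaProd hC l (hs.symm ▸ hc))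
    (C.verticalIntegrable_foxKernel hC l hc) hMx, div_div_cancel₀ hM.ne']
  exact (Complex.continuous_ofReal.comp (continuous_cdf _)).continuousAt.comp
    (continuousAt_const.div continuousAt_id hMx.ne')

theorem foxSeparates (hC : ∀ k, 0 < C.scale k) (l : Fin K → ℕ) {c : ℝ} (hc : 0 < c) :
    FoxSeparates 1 K (C.foxUp l) foxLow c := by
  refine ⟨fun j _ _ => by simpa [foxLow] using hc, fun i hi hA => ?_⟩
  have hlast : i = Fin.castSucc ⟨i, hi⟩ := rfl
  rw [hlast, foxUp, Fin.snoc_castSucc] at hA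
  exact absurd hA (one_div_pos.2 (hC _)).ne'

end FoxFunction

section Outage

variable {S : Type*} (α : Fin (K + 1) → S → ℂ)

theorem one_add_snr_pos (hP : ∀ k, 0 ≤ C.P k) (k : Fin K) (ω : S) : 0 < 1 + C.snr α k ω :=
  add_pos_of_pos_of_nonneg one_pos (mul_nonneg (hP k) (sq_nonneg _))

theorem G_pos (hP : ∀ k, 0 ≤ C.P k) (ω : S) : 0 < C.G α ω :=
  Finset.prod_pos fun k _ => C.one_add_snr_pos α hP k ω

theorem ae_map_G_pos (hP : ∀ k, 0 ≤ C.P k) [MeasurableSpace S] {μ : Measure S}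
    (hG : AEMeasurable (C.G α) μ) : ∀ᵐ t ∂μ.map (C.G α), 0 < t :=
  (ae_map_iff hG measurableSet_Ioi).2 (ae_of_all _ (C.G_pos α hP))

theorem info_lt_iff (hP : ∀ k, 0 ≤ C.P k) (R : ℝ) (ω : S) :
    C.info α ω < R ↔ C.G α ω < 2 ^ R := by
  have hinfo : C.info α ω = Real.logb 2 (C.G α ω) := by
    rw [info, G, Real.logb_prod _ _ fun k _ => (C.one_add_snr_pos α hP k ω).ne']
  rw [hinfo, Real.logb_lt_iff_lt_rpow one_lt_two (C.G_pos α hP ω)]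

theorem outage_eq_cdf (hP : ∀ k, 0 ≤ C.P k) [MeasurableSpace S] {μ : Measure S}
    [IsProbabilityMeasure μ] (hG : AEMeasurable (C.G α) μ) (hac : μ.map (C.G α) ≪ volume)
    (R : ℝ) : C.outage α μ R = cdf (μ.map (C.G α)) (2 ^ R) := by
  have := Measure.isProbabilityMeasure_map hG
  have hevent : {ω | C.info α ω < R} = C.G α ⁻¹' Set.Iio (2 ^ R) :=
    Set.ext fun ω => C.info_lt_iff α hP R ω
  rw [outage, hevent, ← map_measureReal_apply_of_aemeasurable hG measurableSet_Iio, cdf_eq_real]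
  exact measureReal_congr (hac.ae_le Iio_ae_eq_Iic)

end Outage

end Channel

end HarqIR

theorem corollary1 {K : ℕ} (hK : 1 ≤ K) (C : HarqIR.Channel K)
    (hP : ∀ k, 0 < C.P k) (hσ : ∀ k, 0 < C.σ k)
    (hρ : |C.ρ| < 1) (hδ : 0 < C.δ) (hρδ : 0 ≤ C.ρ ∨ ∃ d : ℕ, C.δ = d)
    {S : Type*} [MeasurableSpace S] (μ : MeasureTheory.Measure S)
    [MeasureTheory.IsProbabilityMeasure μ]
    (α : Fin (K + 1) → S → ℂ)
    (hα : ∀ i, ProbabilityTheory.HasLaw (α i) HarqIR.stdComplexNormal μ)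
    (hind : ProbabilityTheory.iIndepFun α μ) :
    -- the weights are the probabilities of a distribution on `ℕ^K`
    ((∀ l, 0 ≤ C.weight l) ∧ HasSum C.weight 1) ∧
    -- `F_G(x) = ∫_0^x f_G(t) dt`, with `f_G` the density of `G`
    (μ.map (C.G α)) ≪ MeasureTheory.volume ∧
    (∀ x : ℝ, ProbabilityTheory.cdf (μ.map (C.G α)) x =
      ∫ t in (0 : ℝ)..x, HarqIR.density (μ.map (C.G α)) t) ∧
    -- `F_{A_l}(x) = ∫_0^x f_{A_l}(t) dt`, with `f_{A_l}` the density of `A_l`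
    (∀ l, C.shiftedGammaProd l ≪ MeasureTheory.volume ∧
      ∀ x : ℝ, ProbabilityTheory.cdf (C.shiftedGammaProd l) x =
        ∫ t in (0 : ℝ)..x, HarqIR.density (C.shiftedGammaProd l) t) ∧
    -- `F_G(x) = ∑_l W_l F_{A_l}(x)`
    (∀ x : ℝ, HasSum (fun l => C.weight l * ProbabilityTheory.cdf (C.shiftedGammaProd l) x)
      (ProbabilityTheory.cdf (μ.map (C.G α)) x)) ∧
    -- `F_{A_l}(x)` as a generalized Fox H-function `Y^{1,K}_{K+1,1}`
    (∀ l, ∀ c : ℝ, 0 < c →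
      HarqIR.FoxSeparates 1 K (C.foxUp l) HarqIR.Channel.foxLow c ∧
      Complex.VerticalIntegrable
        (HarqIR.foxKernel 1 K (C.foxUp l) HarqIR.Channel.foxLow) c ∧
      ∀ x : ℝ, 0 < x →
        ((ProbabilityTheory.cdf (C.shiftedGammaProd l) x : ℝ) : ℂ) =
          HarqIR.foxY c 1 K (C.foxUp l) HarqIR.Channel.foxLow ((∏ k, C.scale k) / x)) ∧
    -- `p_out,K = F_G(2^R) = ∑_l W_l F_{A_l}(2^R)`
    (∀ R : ℝ, C.outage α μ R = ProbabilityTheory.cdf (μ.map (C.G α)) (2 ^ R) ∧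
      HasSum (fun l => C.weight l * ProbabilityTheory.cdf (C.shiftedGammaProd l) (2 ^ R))
        (C.outage α μ R)) := by
  have : NeZero K := ⟨Nat.one_le_iff_ne_zero.1 hK⟩
  have hP' := fun k => (hP k).le
  have hC := C.scale_pos hP (fun k => (hσ k).ne') hρ hδ
  have hG := C.aemeasurable_G fun i => (hα i).aemeasurable
  have hGac := C.map_G_absolutelyContinuous hC hρ hδ hρδ hα hind
  have := Measure.isProbabilityMeasure_map hG
  have := C.isProbabilityMeasure_shiftedGammaProd hC
  have hAac := C.shiftedGammaProd_absolutelyContinuous hC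
  have hApos := fun l => (C.ae_one_le_shiftedGammaProd hC l).mono fun _ => one_pos.trans_le
  have hmix := C.hasSum_weight_mul_cdf hC hρ hδ hρδ hα hind
  refine ⟨⟨C.weight_nonneg hρ hδ hρδ, C.hasSum_weight hρ hδ hρδ⟩, hGac,
    HarqIR.cdf_eq_integral_density _ hGac (C.ae_map_G_pos α hP' hG),
    fun l => ⟨hAac l, HarqIR.cdf_eq_integral_density _ (hAac l) (hApos l)⟩, hmix,
    fun l c hc => ⟨C.foxSeparates hC l hc, C.verticalIntegrable_foxKernel hC l hc,
      fun x hx => C.cdf_eq_foxY hC l hc hx⟩, fun R => ?_⟩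
  have hout := C.outage_eq_cdf α hP' hG hGac R
  exact ⟨hout, hout ▸ hmix _⟩
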